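/- Let $\alpha_1,\alpha_2\in M_{\kappa\times\kappa}(\mathbb C)$, $a\in M_{N\times\kappa}(\mathbb C)$, $b\in M_{\kappa\times N}(\mathbb C)$ satisfy $[\alpha_1,\alpha_2]+ba=0$, and for $X=(x,y,z)$ put $$A_X=\begin{pmatrix}x+z\alpha_1\\ y+z\alpha_2\\ za\end{pmatrix}:\mathbb C^{\kappa}\to K=\mathbb C^\kappa\oplus\mathbb C^\kappa\oplus\mathbb C^N,\qquad B_X=\begin{pmatrix}-y-z\alpha_2& x+z\alpha_1& zb\end{pmatrix}:K\to\mathbb C^\kappa .$$ Assume that $A_X$ is injective and $B_X$ is surjective for all $X\ne0$, and let $E$ be the holomorphic vector bundle on $\mathbb P^2$ with fibres $E_X=\ker B_X/\operatorname{im}A_X$, framed on the line $z=0$ by $r\mapsto[(0,0,r)]$, $r\in\mathbb C^N$. Let $p_1<\dots<p_N$ be integers or half-integers, and suppose the monad is $\mathbb C^\times$-invariant with weights $p_j$: there are homomorphisms $\sigma,\tau:\mathbb C^\times\to GL(\kappa,\mathbb C)$ and $\rho:\mathbb C^\times\to GL(K)$ of the double cover of $\mathbb C^\times$, with parameter $t$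 and $c=t^2$, such that $\rho(t)A_{(x,y,z)}=A_{(x,cy,z)}\sigma(t)$, $\tau(t)B_{(x,y,z)}=B_{(x,cy,z)}\rho(t)$ and $\rho(t)(0,0,r)=(0,0,\operatorname{diag}(c^{p_1},\dots,c^{p_N})r)$, where $c^{p_j}=t^{2p_j}$. Thus $\mathbb C^\times$ acts on $E$ through $\rho$, covering the action $[x:y:z]\mapsto[x:cy:z]$, whose fixed points are those of the line $\mathbb P^1_+=\{y=0\}$ and the point $[0:1:0]$, in which $\mathbb P^2$ meets the other fixed line $\mathbb P^1_-$. Over $\mathbb P^1_+$ the $j$-th factor of the splitting of $E$ is the part on which $\mathbb C^\times$ acts by $c^{p_j}$. Then on $\mathbb P^2\setminus\{[0:1:0]\}=\mathbb P^2\setminus\mathbb P^1_-$ there is a unique chain $L_1^+\subset L_2^+\subset\dots\subset L_{N-1}^+$ of holomorphic sub-bundles of $E$, with $L_i^+$ of rank $i$, that are preserved by the $\mathbb C^\times$-action and such that $L_i^+|_{\mathbb P^1_+}$ is the sum of the last $i$ factors of the splitting of $E|_{\mathbb P^1_+}$, for each $i$. Moreover, let $h\neq 0$ and consider the horosphere line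 $y=-hz$, the closure of $\{[x:h:-1]\}$. At each of its points $X$, $\mathbb C^N$ is identified with $E_X$, where $r\in\mathbb C^N$ corresponds to the class of any element of $\ker B_X$ of the form $(v,0,r)$. Sending $u=[x:z]\in\mathbb P^1$ to the fibre of $L_1^+\subset\dots\subset L_{N-1}^+$ at $[x:-hz:z]$, regarded as a flag in $\mathbb C^N$ by this identification, defines a rational map (a morphism of algebraic varieties) from $\mathbb P^1$ to the manifold of full flags in $\mathbb C^N$. -/

import Mathlib

open scoped LinearAlgebra.Projectivization Topology

noncomputable section

namespace HyperbolicMonopole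

/-! ### Projective spaces as complex manifolds -/

/-- The quotient topology of projective space. -/
instance projTopology (V : Type*) [AddCommGroup V] [Module ℂ V] [TopologicalSpace V] :
    TopologicalSpace (ℙ ℂ V) :=
  inferInstanceAs (TopologicalSpace (Quotient (projectivizationSetoid ℂ V)))

/-- A function `f` on a projective space is holomorphic near the point `p` if its pull-back to the
punctured cone `V ∖ {0}` is holomorphic near a representative of `p` (the projection of the cone
onto the projective space is a holomorphic submersion). -/
def HolomorphicAt {V F : Type*} [NormedAddCommGroup V] [NormedSpace ℂ V]
    [NormedAddCommGroup F] [NormedSpace ℂ F] (f : ℙ ℂ V → F) (p : ℙ ℂ V) : Prop :=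
  ∃ g : V → F, AnalyticAt ℂ g p.rep ∧
    ∀ᶠ X in 𝓝 p.rep, ∀ hX : X ≠ 0, g X = f (Projectivization.mk ℂ X hX)

/-- The projective plane with homogeneous coordinates `[x : y : z]`, where
`x = X 0`, `y = X 1`, `z = X 2`. -/
abbrev P2 := ℙ ℂ (Fin 3 → ℂ)

/-- The projective line. -/
abbrev P1 := ℙ ℂ (Fin 2 → ℂ)

/-! ### The `ℂˣ`-action on the plane

The action is `[x : y : z] ↦ [x : c y : z]`. As the weights `p_i` may be half-integers, the acting
group is the double cover, with parameter `t`, `c = t ^ 2`. -/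

/-- `(x, y, z) ↦ (x, t² y, z)`. -/
def rotVec (t : ℂˣ) : (Fin 3 → ℂ) →ₗ[ℂ] (Fin 3 → ℂ) where
  toFun X := ![X 0, (t : ℂ) ^ 2 * X 1, X 2]
  map_add' X Y := by
    funext i
    fin_cases i <;> simp [mul_add]
  map_smul' c X := by
    funext i
    fin_cases i <;> simp [mul_left_comm]

theorem rotVec_injective (t : ℂˣ) : Function.Injective (rotVec t) := by
  intro X Y h
  have h0 := congrFun h 0
  have h1 := congrFun h 1
  have h2 := congrFun h 2
  simp [rotVec] at h0 h1 h2
  funext i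
  fin_cases i <;> simp [h0, h1, h2]

/-- The action of `t` on the plane. -/
def rot (t : ℂˣ) : P2 → P2 := Projectivization.map (rotVec t) (rotVec_injective t)

/-- The line `y = 0` of fixed points. -/
def linePlus : Set P2 := {p | p.rep 1 = 0}

/-- The plane minus the other fixed line: that line meets the plane in the point `[0 : 1 : 0]`. -/
def complMinus : Set P2 := {p | ¬ (p.rep 0 = 0 ∧ p.rep 2 = 0)}

theorem rot_of_mem_linePlus (t : ℂˣ) {p : P2} (hp : p ∈ linePlus) : rot t p = p := by
  have h : rotVec t p.rep = p.rep := by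
    funext i
    have hp' : p.rep 1 = 0 := hp
    fin_cases i <;> simp [rotVec, hp']
  conv_lhs => rw [← p.mk_rep]
  conv_rhs => rw [← p.mk_rep]
  simp only [rot, Projectivization.map_mk, h]

theorem linePlus_subset_complMinus : linePlus ⊆ complMinus := by
  rintro p hp ⟨h0, h2⟩
  apply p.rep_nonzero
  funext i
  have hp' : p.rep 1 = 0 := hp
  fin_cases i <;> simp [h0, h2, hp']

/-! ### Monads and their cohomology bundle -/

/-- The middle term `K = ℂ^κ ⊕ ℂ^κ ⊕ ℂ^N` of the monad. -/
abbrev Mid (κ N : ℕ) := (Fin κ → ℂ) × (Fin κ → ℂ) × (Fin N → ℂ)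

/-- The map `A_X = (x + z α₁, y + z α₂, z a)`. -/
def mapA {κ N : ℕ} (α₁ α₂ : Matrix (Fin κ) (Fin κ) ℂ) (a : Matrix (Fin N) (Fin κ) ℂ)
    (X : Fin 3 → ℂ) : (Fin κ → ℂ) →ₗ[ℂ] Mid κ N :=
  (X 0 • LinearMap.id + X 2 • α₁.mulVecLin).prod
    ((X 1 • LinearMap.id + X 2 • α₂.mulVecLin).prod (X 2 • a.mulVecLin))

/-- The map `B_X = (-y - z α₂, x + z α₁, z b)`. -/
def mapB {κ N : ℕ} (α₁ α₂ : Matrix (Fin κ) (Fin κ) ℂ) (b : Matrix (Fin κ) (Fin N) ℂ)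
    (X : Fin 3 → ℂ) : Mid κ N →ₗ[ℂ] (Fin κ → ℂ) :=
  (-(X 1 • LinearMap.id + X 2 • α₂.mulVecLin)).coprod
    ((X 0 • LinearMap.id + X 2 • α₁.mulVecLin).coprod (X 2 • b.mulVecLin))

/-- A framed monad on the projective plane: ADHM matrices that satisfy the complex ADHM equation
and for which `A_X` is injective and `B_X` is surjective at every point. -/
structure FramedMonad (κ N : ℕ) where
  α₁ : Matrix (Fin κ) (Fin κ) ℂ
  α₂ : Matrix (Fin κ) (Fin κ) ℂ
  a : Matrix (Fin N) (Fin κ) ℂ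
  b : Matrix (Fin κ) (Fin N) ℂ
  adhm : α₁ * α₂ - α₂ * α₁ + b * a = 0
  injective_A : ∀ X : Fin 3 → ℂ, X ≠ 0 → Function.Injective (mapA α₁ α₂ a X)
  surjective_B : ∀ X : Fin 3 → ℂ, X ≠ 0 → Function.Surjective (mapB α₁ α₂ b X)

namespace FramedMonad

variable {κ N : ℕ} (D : FramedMonad κ N)

/-- The map `A_X`. -/
abbrev A (X : Fin 3 → ℂ) : (Fin κ → ℂ) →ₗ[ℂ] Mid κ N := mapA D.α₁ D.α₂ D.a X

/-- The map `B_X`. -/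
abbrev B (X : Fin 3 → ℂ) : Mid κ N →ₗ[ℂ] (Fin κ → ℂ) := mapB D.α₁ D.α₂ D.b X

/-- `A_X` is linear in `X`. -/
theorem A_smul (c : ℂ) (X : Fin 3 → ℂ) : D.A (c • X) = c • D.A X := by
  apply LinearMap.ext
  intro w
  simp [A, mapA, smul_add, mul_smul]

/-- `B_X` is linear in `X`. -/
theorem B_smul (c : ℂ) (X : Fin 3 → ℂ) : D.B (c • X) = c • D.B X := by
  apply LinearMap.ext
  intro w
  simp [B, mapB, smul_add, mul_smul]

/-- `ker B` at a point of the plane. -/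
def ker (p : P2) : Submodule ℂ (Mid κ N) := LinearMap.ker (D.B p.rep)

/-- `im A` at a point of the plane. -/
def im (p : P2) : Submodule ℂ (Mid κ N) := LinearMap.range (D.A p.rep)

theorem ker_mk (X : Fin 3 → ℂ) (hX : X ≠ 0) :
    D.ker (Projectivization.mk ℂ X hX) = LinearMap.ker (D.B X) := by
  obtain ⟨c, hc⟩ := Projectivization.exists_smul_eq_mk_rep ℂ X hX
  have hc' : (c : ℂ) • X = (Projectivization.mk ℂ X hX).rep := hc
  rw [ker, ← hc', B_smul, LinearMap.ker_smul _ _ c.ne_zero]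

theorem im_mk (X : Fin 3 → ℂ) (hX : X ≠ 0) :
    D.im (Projectivization.mk ℂ X hX) = LinearMap.range (D.A X) := by
  obtain ⟨c, hc⟩ := Projectivization.exists_smul_eq_mk_rep ℂ X hX
  have hc' : (c : ℂ) • X = (Projectivization.mk ℂ X hX).rep := hc
  rw [im, ← hc', A_smul, LinearMap.range_smul _ _ c.ne_zero]

/-- The fibre `E_p = ker B_p / im A_p` of the cohomology bundle. (`im A_p ⊆ ker B_p` by the complex
ADHM equation.) -/
abbrev E (p : P2) : Type := D.ker p ⧸ (D.im p).submoduleOf (D.ker p)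

/-- The class in `E_p` of an element of `ker B_p`. -/
abbrev cls (p : P2) : D.ker p →ₗ[ℂ] D.E p := ((D.im p).submoduleOf (D.ker p)).mkQ

/-- A family of subspaces of the fibres of `E` over the complement of `[0 : 1 : 0]` is a holomorphic
sub-bundle of rank `r` if near every point of this open set there are `r` holomorphic sections of
`E` (classes of holomorphic functions with values in `ker B`) that form a basis of each subspace. -/
def IsHolomorphicSubbundle (r : ℕ) (L : ∀ q : complMinus, Submodule ℂ (D.E q)) : Prop :=
  ∀ p : complMinus, ∃ s : Fin r → P2 → Mid κ N,
    (∀ j, HolomorphicAt (s j) p) ∧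
    ∀ᶠ q : complMinus in 𝓝 p, ∃ hs : ∀ j, s j q ∈ D.ker q,
      LinearIndependent ℂ (fun j => D.cls q ⟨s j q, hs j⟩) ∧
      Submodule.span ℂ (Set.range fun j => D.cls q ⟨s j q, hs j⟩) = L q

end FramedMonad

/-! ### Circle invariance -/

/-- A framed monad is `ℂˣ`-invariant with weights `p_j = m j / 2`, `c = t ^ 2`: the group acts
linearly on the three terms of the monad, the monad maps are equivariant, and on the framing
`ℂ^N` the action is `λ(c) = diag (c ^ p_1, …, c ^ p_N)`. -/
structure CircleAction {κ N : ℕ} (D : FramedMonad κ N) (m : Fin N → ℤ) where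
  σ : ℂˣ →* ((Fin κ → ℂ) ≃ₗ[ℂ] (Fin κ → ℂ))
  ρ : ℂˣ →* (Mid κ N ≃ₗ[ℂ] Mid κ N)
  τ : ℂˣ →* ((Fin κ → ℂ) ≃ₗ[ℂ] (Fin κ → ℂ))
  equivariant_A : ∀ t X w, ρ t (D.A X w) = D.A (rotVec t X) (σ t w)
  equivariant_B : ∀ t X v, τ t (D.B X v) = D.B (rotVec t X) (ρ t v)
  framing : ∀ t (r : Fin N → ℂ), ρ t (0, 0, r) = (0, 0, fun j => (t : ℂ) ^ m j * r j)

namespace CircleAction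

variable {κ N : ℕ} {D : FramedMonad κ N} {m : Fin N → ℤ} (C : CircleAction D m)

theorem rotVec_rep_ne_zero (t : ℂˣ) (p : P2) : rotVec t p.rep ≠ 0 := fun h =>
  p.rep_nonzero (rotVec_injective t (by rw [h, map_zero]))

theorem rot_eq_mk (t : ℂˣ) (p : P2) :
    rot t p = Projectivization.mk ℂ (rotVec t p.rep) (rotVec_rep_ne_zero t p) := by
  conv_lhs => rw [← p.mk_rep]
  rfl

theorem ρ_mem_ker (t : ℂˣ) {p q : P2} (h : rot t p = q) (v : Mid κ N) (hv : v ∈ D.ker p) :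
    C.ρ t v ∈ D.ker q := by
  rw [← h, rot_eq_mk, D.ker_mk, LinearMap.mem_ker, ← C.equivariant_B]
  have hv' : D.B p.rep v = 0 := hv
  rw [hv', map_zero]

theorem ρ_mem_im (t : ℂˣ) {p q : P2} (h : rot t p = q) (v : Mid κ N) (hv : v ∈ D.im p) :
    C.ρ t v ∈ D.im q := by
  obtain ⟨w, rfl⟩ := hv
  rw [← h, rot_eq_mk, D.im_mk, C.equivariant_A]
  exact ⟨_, rfl⟩

/-- The action `E_p → E_{t · p}` on the cohomology bundle. -/
def act (t : ℂˣ) {p q : P2} (h : rot t p = q) : D.E p →ₗ[ℂ] D.E q :=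
  Submodule.mapQ _ _ ((C.ρ t : Mid κ N →ₗ[ℂ] Mid κ N).restrict (C.ρ_mem_ker t h))
    (fun v hv => C.ρ_mem_im t h v hv)

/-- For a point `p` of the fixed line `y = 0`, the fibre at `p` of the `j`-th factor in the splitting
of `E` over this line: the subspace of `E_p` on which `ℂˣ` acts with weight `c ^ p_j = t ^ m j`. -/
def factor (j : Fin N) (p : P2) (hp : p ∈ linePlus) : Submodule ℂ (D.E p) :=
  ⨅ t : ℂˣ, LinearMap.ker
    (C.act t (rot_of_mem_linePlus t hp) - ((t : ℂ) ^ m j) • LinearMap.id)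

/-- `L 0 ⊆ L 1 ⊆ … ⊆ L (N - 2)` is a chain of `ℂˣ`-invariant holomorphic sub-bundles of `E` over the
complement of `[0 : 1 : 0]`, with `L i` of rank `i + 1`, that restricts over the line `y = 0` to the
sums of the last `i + 1` factors of the splitting of `E`. -/
structure IsInvariantChain
    (L : Fin (N - 1) → ∀ q : complMinus, Submodule ℂ (D.E q)) : Prop where
  subbundle : ∀ i, D.IsHolomorphicSubbundle (i.1 + 1) (L i)
  chain : ∀ i j, i ≤ j → ∀ q, L i q ≤ L j q
  invariant : ∀ i (t : ℂˣ) (p q : complMinus) (h : rot t p.1 = q.1),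
    (L i p).map (C.act t h) = L i q
  restrict : ∀ i (p : P2) (hp : p ∈ linePlus),
    L i ⟨p, linePlus_subset_complMinus hp⟩ =
      ⨆ (j : Fin N) (_ : N ≤ j.1 + (i.1 + 1)), C.factor j p hp

end CircleAction

/-! ### The rational map -/

/-- `(x, z) ↦ (x, -h z, z)`, a parametrisation of the horosphere line `y = -h z`,
that is, of the closure of `{[x : h : -1]}`. -/
def horoVec (h : ℂ) : (Fin 2 → ℂ) →ₗ[ℂ] (Fin 3 → ℂ) where
  toFun u := ![u 0, -h * u 1, u 1]
  map_add' u v := by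
    funext i
    fin_cases i <;> simp [mul_add]
  map_smul' c u := by
    funext i
    fin_cases i <;> simp [mul_left_comm]

theorem horoVec_injective (h : ℂ) : Function.Injective (horoVec h) := by
  intro u v huv
  have h0 := congrFun huv 0
  have h2 := congrFun huv 2
  simp [horoVec] at h0 h2
  funext i
  fin_cases i <;> simp [h0, h2]

/-- The point of the horosphere line with parameter `u = [x : z]`. It lies on the `ℂˣ`-orbit (or is
the fixed point, if `z = 0`) whose limit as `c → 0` is the point `[x : 0 : z]` of the line `y = 0`. -/
def horoPoint (h : ℂ) (u : P1) : P2 := Projectivization.map (horoVec h) (horoVec_injective h) u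

theorem horoPoint_mem (h : ℂ) (u : P1) : horoPoint h u ∈ complMinus := by
  have e : horoPoint h u = Projectivization.mk ℂ (horoVec h u.rep)
      (fun e => u.rep_nonzero (horoVec_injective h (by rw [e, map_zero]))) := by
    conv_lhs => rw [← u.mk_rep]
    rfl
  obtain ⟨c, hc⟩ := Projectivization.exists_smul_eq_mk_rep ℂ (horoVec h u.rep)
    (fun e => u.rep_nonzero (horoVec_injective h (by rw [e, map_zero])))
  rw [← e] at hc
  rintro ⟨h0, h2⟩
  rw [← hc] at h0 h2
  have k0 : (c : ℂ) * u.rep 0 = 0 := h0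
  have k2 : (c : ℂ) * u.rep 1 = 0 := h2
  apply u.rep_nonzero
  funext i
  fin_cases i
  · simpa using k0
  · simpa using k2

namespace FramedMonad

variable {κ N : ℕ} (D : FramedMonad κ N)

/-- `r ∈ ℂ^N` corresponds to `e ∈ E_p` in the extension of the framing to a horosphere line:
`e` is the class of an element `(v, 0, r)` of `ker B_p`. At `[x : h : -1]` this forces
`v = -(h - α₂)⁻¹ b r`, and on the line `z = 0` it is the given framing. -/
def Frames (p : P2) (r : Fin N → ℂ) (e : D.E p) : Prop :=
  ∃ (v : Fin κ → ℂ) (hv : ((v, 0, r) : Mid κ N) ∈ D.ker p), D.cls p ⟨(v, 0, r), hv⟩ = e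

/-- The relation `Frames` identifies `ℂ^N` with `E_p`. -/
def IsFramedAt (p : P2) : Prop :=
  (∀ r, ∃! e, D.Frames p r e) ∧ (∀ e, ∃! r, D.Frames p r e)

end FramedMonad

/-- Full flags `V 0 ⊆ V 1 ⊆ … ⊆ V (N - 2)` in `ℂ^N`, with `dim (V i) = i + 1`. -/
structure FullFlag (N : ℕ) where
  V : Fin (N - 1) → Submodule ℂ (Fin N → ℂ)
  finrank_eq : ∀ i, Module.finrank ℂ (V i) = i.1 + 1
  mono : Monotone V

/-- A map from the projective line to the flag manifold is rational (a morphism of algebraic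
varieties) if, Zariski-locally on the line, the members of the flag have bases whose coordinates
are homogeneous polynomials of the same degree. -/
def FullFlag.IsRational {N : ℕ} (f : P1 → FullFlag N) : Prop :=
  ∀ (i : Fin (N - 1)) (u₀ : P1), ∃ (d e : ℕ) (g : MvPolynomial (Fin 2) ℂ)
    (w : Fin (i.1 + 1) → Fin N → MvPolynomial (Fin 2) ℂ),
    g.IsHomogeneous e ∧ (∀ j k, (w j k).IsHomogeneous d) ∧ MvPolynomial.eval u₀.rep g ≠ 0 ∧
    ∀ (u : Fin 2 → ℂ) (hu : u ≠ 0), MvPolynomial.eval u g ≠ 0 →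
      LinearIndependent ℂ (fun j k => MvPolynomial.eval u (w j k)) ∧
      Submodule.span ℂ (Set.range fun j k => MvPolynomial.eval u (w j k)) =
        (f (Projectivization.mk ℂ u hu)).V i

end HyperbolicMonopole

end

noncomputable section

namespace HyperbolicMonopole

open Module
open scoped Matrix

/-! ### Gradings by the integers -/

/-! The sub-bundles come from a filtration of the monad itself. Equivariance says that `α₁` and `a`
preserve weights, while `α₂` and `b` lower them by 2. Let $F_n$ be the part of weight at least n, in
ℂ^κ and in K. Then $A_X$ and $B_X$ respect these filtrations (up to a shift by 2 for $B_X$), and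
their leading terms are $A$ and $B$ at the limit (x, 0, z) of the orbit of X. Away from [0:1:0] this
limit is nonzero, so the leading terms are injective and surjective; hence $A_X$ is strict
(`mem_filt_of_A`) and $B_X$ is onto on every step (`exists_B_eq`). The classes of kernel elements in
$F_n$ therefore form a subspace `filtE n` of the fibre whose dimension is the number of weights ≥ n
(`finrank_filtE`), and Cramer's rule gives it local polynomial frames (`exists_frame`). On y = 0 the
monad maps are graded, and `filtE n` is the sum of the factors of weight ≥ n
(`filtE_eq_iSup_factor`).

The homomorphisms of the action are abstract, so integral weights have to be proved to exist: the
weight vectors of σ span ℂ^κ because their span contains im b and is stable under `α₁` and `α₂`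
(`span_weights`, `eq_top_of_stable`).

Uniqueness: a vector of an invariant sub-bundle, pushed along its orbit to y = 0 and rescaled,
converges to its leading component, which lies in the sub-bundle because sub-bundles are closed.
Prescribing the restriction to y = 0 thus removes the low components one by one (`le_filtE`), and
ranks give equality.

Rationality: `α₂` lowers weights, so `α₂` - h is invertible for h ≠ 0, and $(v_1, v_2, r) ↦ r -
a(α_2 - h)^{-1}v_2$ inverts the framing at every point of the line y = -hz. This map does not depend
on the point, so it carries polynomial frames to polynomial frames (`isRational_flag`). -/

/-- A grading of a vector space by the integers, with finitely many degrees, given by the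
projections onto the homogeneous components. -/
structure Grading (V : Type*) [AddCommGroup V] [Module ℂ V] where
  proj : ℤ → V →ₗ[ℂ] V
  support : Finset ℤ
  proj_proj : ∀ k l v, proj k (proj l v) = if k = l then proj l v else 0
  sum_proj : ∀ v, ∑ k ∈ support, proj k v = v

namespace Grading

variable {V : Type*} [AddCommGroup V] [Module ℂ V] (G : Grading V)

theorem proj_self (k : ℤ) (v : V) : G.proj k (G.proj k v) = G.proj k v := by
  simp [G.proj_proj]

theorem proj_of_ne {k l : ℤ} (h : k ≠ l) (v : V) : G.proj k (G.proj l v) = 0 := by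
  simp [G.proj_proj, h]

theorem proj_eq_zero {k : ℤ} (hk : k ∉ G.support) (v : V) : G.proj k v = 0 := by
  conv_lhs => rw [← G.sum_proj v, map_sum]
  refine Finset.sum_eq_zero fun l hl => G.proj_of_ne ?_ v
  rintro rfl
  exact hk hl

theorem sum_proj_of_subset {J : Finset ℤ} (hJ : G.support ⊆ J) (v : V) :
    ∑ k ∈ J, G.proj k v = v := by
  conv_rhs => rw [← G.sum_proj v]
  exact (Finset.sum_subset hJ fun k _ hk => G.proj_eq_zero hk v).symm

theorem eq_zero_of_proj {v : V} (h : ∀ k, G.proj k v = 0) : v = 0 := by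
  rw [← G.sum_proj v]
  exact Finset.sum_eq_zero fun k _ => h k

/-- A linear map that takes vectors of degree `l` to vectors of degree `l + d` is compatible with
the projections. -/
theorem proj_map {W : Type*} [AddCommGroup W] [Module ℂ W] (H : Grading W) (f : V →ₗ[ℂ] W) (d : ℤ)
    (h : ∀ k l v, H.proj k (f (G.proj l v)) = if k = l + d then f (G.proj l v) else 0)
    (k : ℤ) (v : V) : H.proj (k + d) (f v) = f (G.proj k v) := by
  conv_lhs => rw [← G.sum_proj v, map_sum, map_sum]
  simp only [h, add_left_inj]
  by_cases hk : k ∈ G.support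
  · rw [Finset.sum_ite_eq, if_pos hk]
  · rw [Finset.sum_ite_eq, if_neg hk, G.proj_eq_zero hk, map_zero]

/-! ### The decreasing filtration attached to a grading -/

/-- The vectors all of whose components have degree at least `k`. -/
def filt (k : ℤ) : Submodule ℂ V := ⨅ (l : ℤ) (_ : l < k), LinearMap.ker (G.proj l)

theorem mem_filt {k : ℤ} {v : V} : v ∈ G.filt k ↔ ∀ l < k, G.proj l v = 0 := by
  simp [filt, Submodule.mem_iInf]

theorem proj_mem_filt {k n : ℤ} (h : n ≤ k) (v : V) : G.proj k v ∈ G.filt n :=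
  G.mem_filt.2 fun _ hl => G.proj_of_ne (by omega) v

theorem filt_anti {k l : ℤ} (h : k ≤ l) : G.filt l ≤ G.filt k := fun _ hv =>
  G.mem_filt.2 fun j hj => G.mem_filt.1 hv j (by omega)

theorem mem_filt_succ {k : ℤ} {v : V} (hv : v ∈ G.filt k) (h : G.proj k v = 0) :
    v ∈ G.filt (k + 1) := by
  refine G.mem_filt.2 fun l hl => ?_
  rcases eq_or_ne l k with rfl | hlk
  · exact h
  · exact G.mem_filt.1 hv l (by omega)

theorem sub_mem_filt_succ {k : ℤ} {v w : V} (hv : v ∈ G.filt k) (hw : w ∈ G.filt k)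
    (h : G.proj k w = G.proj k v) : v - w ∈ G.filt (k + 1) :=
  G.mem_filt_succ (sub_mem hv hw) (by rw [map_sub, h, sub_self])

/-- Finiteness of the support makes the filtration constant at both ends, which supplies the base
cases of the two inductions below. -/
theorem exists_filt_eq_top : ∃ k, ∀ l ≤ k, G.filt l = ⊤ := by
  obtain ⟨k, hk⟩ := G.support.finite_toSet.bddBelow
  refine ⟨k, fun l hl => eq_top_iff.2 fun v _ => G.mem_filt.2 fun j hj => G.proj_eq_zero ?_ v⟩
  intro hj'
  have : k ≤ j := hk hj'
  omega

theorem exists_filt_eq_bot : ∃ k, ∀ l ≥ k, G.filt l = ⊥ := by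
  obtain ⟨k, hk⟩ := G.support.finite_toSet.bddAbove
  refine ⟨k + 1, fun l hl => eq_bot_iff.2 fun v hv => ?_⟩
  refine G.eq_zero_of_proj fun j => ?_
  by_cases hj : j ∈ G.support
  · have : j ≤ k := hk hj
    exact G.mem_filt.1 hv j (by omega)
  · exact G.proj_eq_zero hj v

/-- Ascending induction along the filtration. -/
theorem filt_induction {P : ℤ → Prop} (hP : ∀ k, G.filt k = ⊤ → P k) {n : ℤ}
    (step : ∀ k < n, P k → P (k + 1)) : P n := by
  obtain ⟨k₀, h₀⟩ := G.exists_filt_eq_top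
  rcases le_total n k₀ with h | h
  · exact hP n (h₀ n h)
  · have : ∀ k, k₀ ≤ k → k ≤ n → P k := by
      intro k hk
      induction k, hk using Int.leInduction with
      | base => exact fun _ => hP k₀ (h₀ k₀ le_rfl)
      | succ k _ ih => exact fun hk' => step k (by omega) (ih (by omega))
    exact this n h le_rfl

/-- Descending induction along the filtration. -/
theorem filt_induction_down {P : ℤ → Prop} (hP : ∀ k, G.filt k = ⊥ → P k)
    (step : ∀ k, P (k + 1) → P k) (n : ℤ) : P n := by
  obtain ⟨k₀, h₀⟩ := G.exists_filt_eq_bot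
  rcases le_total k₀ n with h | h
  · exact hP n (h₀ n h)
  · induction n, h using Int.leInductionDown with
    | base => exact hP k₀ (h₀ k₀ le_rfl)
    | pred k _ ih => exact step (k - 1) (by rwa [sub_add_cancel])

/-- The grading in which the degrees are shifted by `d`. -/
def shift (d : ℤ) : Grading V where
  proj k := G.proj (k - d)
  support := G.support.image (· + d)
  proj_proj k l v := by
    rw [G.proj_proj]
    by_cases h : k = l <;> simp [h]
  sum_proj v := by
    rw [Finset.sum_image (by intro a _ b _ h; simpa using h)]
    simpa using G.sum_proj v

theorem mem_filt_shift {d k : ℤ} {v : V} : v ∈ (G.shift d).filt k ↔ v ∈ G.filt (k - d) := by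
  rw [mem_filt, mem_filt]
  constructor
  · intro h l hl
    simpa [shift] using h (l + d) (by omega)
  · intro h l hl
    exact h (l - d) (by omega)

theorem filt_shift (d k : ℤ) : (G.shift d).filt k = G.filt (k - d) :=
  Submodule.ext fun _ => G.mem_filt_shift

/-- The sum of two gradings. -/
def prod {W : Type*} [AddCommGroup W] [Module ℂ W] (H : Grading W) : Grading (V × W) where
  proj k := (G.proj k).prodMap (H.proj k)
  support := G.support ∪ H.support
  proj_proj k l v := by
    simp only [LinearMap.prodMap_apply, G.proj_proj, H.proj_proj]
    split_ifs <;> rfl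
  sum_proj v := by
    refine Prod.ext ?_ ?_
    · simpa [Prod.fst_sum] using G.sum_proj_of_subset Finset.subset_union_left v.1
    · simpa [Prod.snd_sum] using H.sum_proj_of_subset Finset.subset_union_right v.2

theorem filt_prod {W : Type*} [AddCommGroup W] [Module ℂ W] (H : Grading W) (k : ℤ) :
    (G.prod H).filt k = (G.filt k).prod (H.filt k) := by
  ext v
  simp only [mem_filt, Submodule.mem_prod, prod, LinearMap.prodMap_apply, Prod.mk_eq_zero]
  exact ⟨fun h => ⟨fun l hl => (h l hl).1, fun l hl => (h l hl).2⟩,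
    fun h l hl => ⟨h.1 l hl, h.2 l hl⟩⟩

/-- The projection of `ℂ^N` to the coordinates of degree `k`, when the `j`-th one has degree
`m j`. -/
def coordProj {N : ℕ} (m : Fin N → ℤ) (k : ℤ) : (Fin N → ℂ) →ₗ[ℂ] (Fin N → ℂ) :=
  LinearMap.pi fun j => if m j = k then LinearMap.proj j else 0

theorem coordProj_apply {N : ℕ} (m : Fin N → ℤ) (k : ℤ) (r : Fin N → ℂ) (j : Fin N) :
    coordProj m k r j = if m j = k then r j else 0 := by
  simp only [coordProj, LinearMap.pi_apply]
  split_ifs <;> rfl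

/-- The grading of `ℂ^N` in which the `j`-th basis vector has degree `m j`. -/
def coord {N : ℕ} (m : Fin N → ℤ) : Grading (Fin N → ℂ) where
  proj := coordProj m
  support := Finset.univ.image m
  proj_proj k l v := by
    funext j
    by_cases h : k = l
    · subst h
      rw [if_pos rfl, coordProj_apply, coordProj_apply]
      split_ifs <;> rfl
    · have h' : m j = k → m j ≠ l := fun h1 h2 => h (h1.symm.trans h2)
      simp only [coordProj_apply, h, if_false, Pi.zero_apply, ite_eq_right_iff]
      intro h1 h2
      exact absurd h2 (h' h1)
  sum_proj v := by
    funext j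
    rw [Finset.sum_apply, Finset.sum_eq_single (m j)]
    · simp [coordProj_apply]
    · intro k _ hk
      simp [coordProj_apply, hk.symm]
    · simp

theorem coord_proj_apply {N : ℕ} (m : Fin N → ℤ) (k : ℤ) (r : Fin N → ℂ) (j : Fin N) :
    (coord m).proj k r j = if m j = k then r j else 0 :=
  coordProj_apply m k r j

theorem mem_filt_coord {N : ℕ} {m : Fin N → ℤ} {k : ℤ} {r : Fin N → ℂ} :
    r ∈ (coord m).filt k ↔ ∀ j, m j < k → r j = 0 := by
  rw [mem_filt]
  constructor
  · intro h j hj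
    simpa [coord_proj_apply] using congrFun (h (m j) hj) j
  · intro h l hl
    funext j
    rw [coord_proj_apply]
    split_ifs with hj
    · exact h j (by omega)
    · rfl

theorem finrank_filt_coord {N : ℕ} (m : Fin N → ℤ) (k : ℤ) :
    finrank ℂ ((coord m).filt k) = (Finset.univ.filter fun j => k ≤ m j).card := by
  have e : (coord m).filt k ≃ₗ[ℂ] ({j // k ≤ m j} → ℂ) :=
    { toFun := fun r j => r.1 j.1
      map_add' := fun _ _ => rfl
      map_smul' := fun _ _ => rfl
      invFun := fun s => ⟨fun j => if h : k ≤ m j then s ⟨j, h⟩ else 0,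
        mem_filt_coord.2 fun j hj => dif_neg (by omega)⟩
      left_inv := fun r => by
        ext j
        by_cases h : k ≤ m j
        · simp [h]
        · simp [h, mem_filt_coord.1 r.2 j (by omega)]
      right_inv := fun s => by
        funext j
        simp [j.2] }
  rw [e.finrank_eq, finrank_fintype_fun_eq_card, Fintype.card_subtype]

theorem finrank_filt_prod {W : Type*} [AddCommGroup W] [Module ℂ W] [FiniteDimensional ℂ V]
    [FiniteDimensional ℂ W] (H : Grading W) (k : ℤ) :
    finrank ℂ ((G.prod H).filt k) = finrank ℂ (G.filt k) + finrank ℂ (H.filt k) := by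
  have e : (G.prod H).filt k ≃ₗ[ℂ] G.filt k × H.filt k :=
    { toFun := fun v =>
        (⟨v.1.1, ((G.filt_prod H k).le v.2).1⟩, ⟨v.1.2, ((G.filt_prod H k).le v.2).2⟩)
      map_add' := fun _ _ => rfl
      map_smul' := fun _ _ => rfl
      invFun := fun v => ⟨(v.1.1, v.2.1), (G.filt_prod H k).ge ⟨v.1.2, v.2.2⟩⟩
      left_inv := fun _ => rfl
      right_inv := fun _ => rfl }
  rw [e.finrank_eq, Module.finrank_prod]

/-! ### Gradings from weight vectors -/

/-- A spanning set of simultaneous eigenvectors of a family of operators, with eigenvalues the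
integral powers of the parameter, gives a grading. -/
theorem exists_of_weights [FiniteDimensional ℂ V] (σ : ℂˣ → V →ₗ[ℂ] V)
    (h : ⊤ ≤ Submodule.span ℂ {v : V | ∃ k : ℤ, ∀ t : ℂˣ, σ t v = (t : ℂ) ^ k • v}) :
    ∃ G : Grading V, (∀ t k v, σ t (G.proj k v) = (t : ℂ) ^ k • G.proj k v) ∧
      ∀ k v, (∀ t : ℂˣ, σ t v = (t : ℂ) ^ k • v) → ∀ l, G.proj l v = if l = k then v else 0 := by
  classical
  -- A spanning set contains a basis, so there is a basis of weight vectors; the projections are the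
  -- coordinate projections grouped by weight.
  let β := Basis.ofSpan h
  have : Fintype ((linearIndepOn_empty ℂ (id : V → V)).extend (Set.empty_subset
      {v : V | ∃ k : ℤ, ∀ t : ℂˣ, σ t v = (t : ℂ) ^ k • v})) :=
    FiniteDimensional.fintypeBasisIndex β
  have hβ : ∀ j, ∃ k : ℤ, ∀ t : ℂˣ, σ t (β j) = (t : ℂ) ^ k • β j := fun j =>
    Basis.ofSpan_subset h ⟨j, rfl⟩
  choose n hn using hβ
  let P : ℤ → V →ₗ[ℂ] V := fun k => β.constr ℂ fun j => if n j = k then β j else 0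
  have hP : ∀ k j, P k (β j) = if n j = k then β j else 0 := fun k j => β.constr_basis ℂ _ j
  have hσP : ∀ t k, σ t ∘ₗ P k = (t : ℂ) ^ k • P k := fun t k => β.ext fun j => by
    by_cases hk : n j = k
    · simp [hP, hk, hn]
    · simp [hP, hk]
  have hPσ : ∀ t k, P k ∘ₗ σ t = (t : ℂ) ^ k • P k := fun t k => β.ext fun j => by
    by_cases hk : n j = k
    · simp [hP, hk, hn]
    · simp [hP, hk, hn]
  have hsum : ∀ v, ∑ k ∈ Finset.univ.image n, P k v = v := by
    intro v
    have : ∑ k ∈ Finset.univ.image n, P k = LinearMap.id := β.ext fun j => by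
      rw [LinearMap.sum_apply, Finset.sum_eq_single (n j)]
      · simp [hP]
      · intro k _ hk
        simp [hP, hk.symm]
      · simp
    simpa using congrArg (fun f : V →ₗ[ℂ] V => f v) this
  have hPP : ∀ k l v, P k (P l v) = if k = l then P l v else 0 := by
    intro k l v
    have : P k ∘ₗ P l = if k = l then P l else 0 := β.ext fun j => by
      by_cases h1 : n j = l
      · by_cases h2 : k = l
        · simp [hP, h1, h2]
        · simp [hP, h1, h2, Ne.symm h2]
      · by_cases h2 : k = l
        · simp [hP, h1, h2]
        · simp [hP, h1, h2]
    have := congrArg (fun f : V →ₗ[ℂ] V => f v) this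
    simp only [LinearMap.comp_apply] at this
    rw [this]
    split_ifs <;> rfl
  let G : Grading V := ⟨P, Finset.univ.image n, hPP, hsum⟩
  refine ⟨G, ?_, ?_⟩
  · exact fun t k v => congrArg (fun f : V →ₗ[ℂ] V => f v) (hσP t k)
  · intro k v hv
    -- The single parameter t = 2 separates all weights, because the integral powers of 2 are
    -- distinct: the component of degree l is multiplied both by 2 ^ l and by 2 ^ k.
    have hne : ∀ l, l ≠ k → G.proj l v = 0 := by
      intro l hl
      have h1 := congrArg (fun f : V →ₗ[ℂ] V => f v) (hPσ (Units.mk0 2 two_ne_zero) l)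
      change G.proj l (σ (Units.mk0 2 two_ne_zero) v) = (2 : ℂ) ^ l • G.proj l v at h1
      simp only [hv, map_smul, Units.val_mk0] at h1
      rw [← sub_eq_zero, ← sub_smul, smul_eq_zero] at h1
      refine h1.resolve_left fun h2 => hl ?_
      have h3 : (2 : ℝ) ^ k = (2 : ℝ) ^ l := by
        rw [sub_eq_zero] at h2
        simpa using congrArg norm h2
      exact (zpow_right_injective₀ (by norm_num) (by norm_num) h3).symm
    intro l
    split_ifs with hl
    · subst hl
      refine (sub_eq_zero.1 (G.eq_zero_of_proj fun j => ?_)).symm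
      rw [map_sub, G.proj_proj]
      split_ifs with hj
      · rw [hj, sub_self]
      · rw [hne j hj, sub_zero]
    · exact hne l hl

end Grading

/-! ### The weights of the action on the monad -/

theorem mapA_apply {κ N : ℕ} (α₁ α₂ : Matrix (Fin κ) (Fin κ) ℂ) (a : Matrix (Fin N) (Fin κ) ℂ)
    (X : Fin 3 → ℂ) (w : Fin κ → ℂ) : mapA α₁ α₂ a X w =
      (X 0 • w + X 2 • α₁ *ᵥ w, X 1 • w + X 2 • α₂ *ᵥ w, X 2 • a *ᵥ w) := rfl

theorem mapB_apply {κ N : ℕ} (α₁ α₂ : Matrix (Fin κ) (Fin κ) ℂ) (b : Matrix (Fin κ) (Fin N) ℂ)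
    (X : Fin 3 → ℂ) (v : Mid κ N) : mapB α₁ α₂ b X v =
      -(X 1 • v.1 + X 2 • α₂ *ᵥ v.1) + (X 0 • v.2.1 + X 2 • α₁ *ᵥ v.2.1 + X 2 • b *ᵥ v.2.2) := by
  simp [mapB, add_assoc]

/-- A subspace that contains the image of `b` and is stable under `α₁` and `α₂` is everything. -/
theorem FramedMonad.eq_top_of_stable {κ N : ℕ} (D : FramedMonad κ N)
    (S : Submodule ℂ (Fin κ → ℂ)) (hb : ∀ r, D.b *ᵥ r ∈ S) (h₁ : ∀ w ∈ S, D.α₁ *ᵥ w ∈ S)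
    (h₂ : ∀ w ∈ S, D.α₂ *ᵥ w ∈ S) : S = ⊤ := by
  by_contra hS
  have hlt : S < ⊤ := lt_top_iff_ne_top.2 hS
  have hadhm : ∀ w, D.α₁ *ᵥ D.α₂ *ᵥ w - D.α₂ *ᵥ D.α₁ *ᵥ w + D.b *ᵥ D.a *ᵥ w = 0 := by
    intro w
    have := congrArg (fun M : Matrix (Fin κ) (Fin κ) ℂ => M *ᵥ w) D.adhm
    simpa [Matrix.add_mulVec, Matrix.sub_mulVec] using this
  let f₁ : (Fin κ → ℂ) →ₗ[ℂ] (Fin κ → ℂ) := D.α₁.mulVecLin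
  let f₂ : (Fin κ → ℂ) →ₗ[ℂ] (Fin κ → ℂ) := D.α₂.mulVecLin
  -- The transposes of `α₁` and `α₂` act on the annihilator `U` of `S`. They commute there, since
  -- functionals in `U` kill im b and the ADHM equation expresses the commutator through b. If `S`
  -- were proper, `U` would be nonzero and contain a common eigenvector φ.
  let U : Submodule ℂ (Dual ℂ (Fin κ → ℂ)) := S.dualAnnihilator
  have hU : ∀ φ, φ ∈ U ↔ ∀ w ∈ S, φ w = 0 := fun φ => Submodule.mem_dualAnnihilator φ
  let g₁ : End ℂ U := (f₁.dualMap).restrict (p := U) (q := U) fun φ hφ =>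
    (hU _).2 fun w hw => (hU φ).1 hφ _ (h₁ w hw)
  have hg₁ : ∀ (φ : U) w, (g₁ φ).1 w = φ.1 (D.α₁ *ᵥ w) := fun _ _ => rfl
  have : Nontrivial U := by
    obtain ⟨φ, hφ, hφS⟩ := Submodule.exists_dual_map_eq_bot_of_lt_top hlt inferInstance
    refine ⟨⟨⟨φ, (hU φ).2 fun w hw => ?_⟩, 0, fun h => hφ (congrArg Subtype.val h)⟩⟩
    exact (Submodule.mem_bot ℂ).1 (hφS ▸ Submodule.mem_map_of_mem hw)
  obtain ⟨x, hx⟩ := End.exists_eigenvalue g₁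
  let g₂ : End ℂ (End.eigenspace g₁ x) :=
    ((f₂.dualMap).restrict (p := U) (q := U) fun φ hφ =>
      (hU _).2 fun w hw => (hU φ).1 hφ _ (h₂ w hw)).restrict (p := End.eigenspace g₁ x)
      (q := End.eigenspace g₁ x) fun φ hφ => by
        rw [End.mem_eigenspace_iff] at hφ ⊢
        refine Subtype.ext (LinearMap.ext fun w => ?_)
        have e1 : φ.1 (D.α₁ *ᵥ D.α₂ *ᵥ w) = x * φ.1 (D.α₂ *ᵥ w) := by
          rw [← hg₁, hφ]; rfl
        have e2 := congrArg φ.1 (hadhm w)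
        rw [map_add, map_sub, (hU φ.1).1 φ.2 _ (hb _), add_zero, map_zero, sub_eq_zero] at e2
        change φ.1 (D.α₂ *ᵥ D.α₁ *ᵥ _) = x * φ.1 (D.α₂ *ᵥ _)
        rw [← e1, e2]
  have : Nontrivial (End.eigenspace g₁ x) := Submodule.nontrivial_iff_ne_bot.2 hx
  obtain ⟨y, hy⟩ := End.exists_eigenvalue (K := ℂ) (V := End.eigenspace g₁ x) g₂
  obtain ⟨φ, hφ⟩ := hy.exists_hasEigenvector
  have k₁ : ∀ w, φ.1.1 (D.α₁ *ᵥ w) = x * φ.1.1 w := fun w => by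
    rw [← hg₁, End.mem_eigenspace_iff.1 φ.2]; rfl
  have k₂ : ∀ w, φ.1.1 (D.α₂ *ᵥ w) = y * φ.1.1 w := fun w =>
    congrArg (fun ψ : End.eigenspace g₁ x => ψ.1.1 w) hφ.apply_eq_smul
  refine hφ.2 (Subtype.ext (Subtype.ext (LinearMap.ext fun w => ?_)))
  -- At the point (-x, -y, 1) given by the two eigenvalues, φ vanishes on the image of `B`, which is
  -- everything; so φ = 0, a contradiction.
  obtain ⟨v, rfl⟩ := D.surjective_B ![-x, -y, 1] (fun h => by simpa using congrFun h 2) w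
  rw [mapB_apply]
  simp [k₁, k₂, (hU φ.1.1).1 φ.1.2 _ (hb _)]

namespace CircleAction

variable {κ N : ℕ} {D : FramedMonad κ N} {m : Fin N → ℤ} (C : CircleAction D m)

/-- Evaluating equivariance at the three coordinate vectors determines ρ and τ from σ and the
framing weights, and then yields the commutation rules of `α₁`, `α₂`, `a`, `b` with σ. -/
theorem ρ_inl (t : ℂˣ) (w : Fin κ → ℂ) : C.ρ t (w, 0, 0) = (C.σ t w, 0, 0) := by
  simpa [mapA_apply, rotVec] using C.equivariant_A t ![1, 0, 0] w

theorem ρ_inm (t : ℂˣ) (w : Fin κ → ℂ) :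
    C.ρ t (0, w, 0) = (0, (t : ℂ) ^ 2 • C.σ t w, 0) := by
  simpa [mapA_apply, rotVec] using C.equivariant_A t ![0, 1, 0] w

theorem ρ_apply (t : ℂˣ) (v : Mid κ N) : C.ρ t v =
    (C.σ t v.1, (t : ℂ) ^ 2 • C.σ t v.2.1, fun j => (t : ℂ) ^ m j * v.2.2 j) := by
  have : v = (v.1, 0, 0) + (0, v.2.1, 0) + (0, 0, v.2.2) := by simp
  conv_lhs => rw [this, map_add, map_add, ρ_inl, ρ_inm, C.framing]
  simp

theorem τ_apply (t : ℂˣ) (w : Fin κ → ℂ) : C.τ t w = (t : ℂ) ^ 2 • C.σ t w := by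
  simpa [mapB_apply, rotVec, ρ_apply] using C.equivariant_B t ![0, 1, 0] (-w, 0, 0)

theorem α₁_σ (t : ℂˣ) (w : Fin κ → ℂ) : D.α₁ *ᵥ C.σ t w = C.σ t (D.α₁ *ᵥ w) := by
  have := C.equivariant_A t ![0, 0, 1] w
  simp only [mapA_apply, ρ_apply, rotVec] at this
  simpa using (congrArg Prod.fst this).symm

theorem α₂_σ (t : ℂˣ) (w : Fin κ → ℂ) :
    D.α₂ *ᵥ C.σ t w = (t : ℂ) ^ 2 • C.σ t (D.α₂ *ᵥ w) := by
  have := C.equivariant_A t ![0, 0, 1] w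
  simp only [mapA_apply, ρ_apply, rotVec] at this
  simpa using (congrArg (fun v => v.2.1) this).symm

theorem a_σ (t : ℂˣ) (w : Fin κ → ℂ) (j : Fin N) :
    (D.a *ᵥ C.σ t w) j = (t : ℂ) ^ m j * (D.a *ᵥ w) j := by
  have := C.equivariant_A t ![0, 0, 1] w
  simp only [mapA_apply, ρ_apply, rotVec] at this
  simpa using (congrFun (congrArg (fun v => v.2.2) this) j).symm

theorem σ_b (t : ℂˣ) (r : Fin N → ℂ) :
    (t : ℂ) ^ 2 • C.σ t (D.b *ᵥ r) = D.b *ᵥ fun j => (t : ℂ) ^ m j * r j := by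
  simpa [mapB_apply, rotVec, ρ_apply, τ_apply] using C.equivariant_B t ![0, 0, 1] (0, 0, r)

/-- The vector `w` has weight `k` under `σ`. -/
def IsWeight (k : ℤ) (w : Fin κ → ℂ) : Prop := ∀ t : ℂˣ, C.σ t w = (t : ℂ) ^ k • w

variable {C} in
theorem IsWeight.α₁ {k : ℤ} {w : Fin κ → ℂ} (h : C.IsWeight k w) :
    C.IsWeight k (D.α₁ *ᵥ w) := fun t => by
  rw [← C.α₁_σ, h t, Matrix.mulVec_smul]

variable {C} in
theorem IsWeight.α₂ {k : ℤ} {w : Fin κ → ℂ} (h : C.IsWeight k w) :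
    C.IsWeight (k - 2) (D.α₂ *ᵥ w) := fun t => by
  have h2 : (t : ℂ) ^ 2 ≠ 0 := pow_ne_zero _ t.ne_zero
  have := C.α₂_σ t w
  rw [h t, Matrix.mulVec_smul] at this
  refine smul_right_injective _ h2 ?_
  change (t : ℂ) ^ 2 • _ = (t : ℂ) ^ 2 • _
  rw [← this, smul_smul, zpow_sub₀ t.ne_zero, zpow_ofNat, mul_div_cancel₀ _ h2]

theorem isWeight_b {k : ℤ} {r : Fin N → ℂ} (hr : ∀ j, m j ≠ k → r j = 0) :
    C.IsWeight (k - 2) (D.b *ᵥ r) := fun t => by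
  have h2 : (t : ℂ) ^ 2 ≠ 0 := pow_ne_zero _ t.ne_zero
  have e : (fun j => (t : ℂ) ^ m j * r j) = (t : ℂ) ^ k • r := by
    funext j
    by_cases h : m j = k
    · simp [h]
    · simp [hr j h]
  have := C.σ_b t r
  rw [e, Matrix.mulVec_smul] at this
  refine smul_right_injective _ h2 ?_
  change (t : ℂ) ^ 2 • _ = (t : ℂ) ^ 2 • _
  rw [this, smul_smul, zpow_sub₀ t.ne_zero, zpow_ofNat, mul_div_cancel₀ _ h2]

/-- No continuity or algebraicity of σ is needed: b sends the j-th basis vector to a vector of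
weight `m j - 2`, and `α₁`, `α₂` send weight vectors to weight vectors, so `eq_top_of_stable`
applies. -/
theorem span_weights : ⊤ ≤ Submodule.span ℂ {w : Fin κ → ℂ | ∃ k : ℤ, C.IsWeight k w} := by
  refine (D.eq_top_of_stable _ ?_ ?_ ?_).ge
  · intro r
    have : r = ∑ j, Pi.single j (r j) := (Finset.univ_sum_single r).symm
    rw [this, Matrix.mulVec_sum]
    refine sum_mem fun j _ => Submodule.subset_span ⟨m j - 2, C.isWeight_b fun i hi => ?_⟩
    exact Pi.single_eq_of_ne (by rintro rfl; exact hi rfl) _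
  · intro w hw
    induction hw using Submodule.span_induction with
    | mem x hx =>
      obtain ⟨k, hk⟩ := hx
      exact Submodule.subset_span ⟨k, hk.α₁⟩
    | zero => simp
    | add x y _ _ hx hy => rw [Matrix.mulVec_add]; exact add_mem hx hy
    | smul c x _ hx => rw [Matrix.mulVec_smul]; exact Submodule.smul_mem _ _ hx
  · intro w hw
    induction hw using Submodule.span_induction with
    | mem x hx =>
      obtain ⟨k, hk⟩ := hx
      exact Submodule.subset_span ⟨k - 2, hk.α₂⟩
    | zero => simp
    | add x y _ _ hx hy => rw [Matrix.mulVec_add]; exact add_mem hx hy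
    | smul c x _ hx => rw [Matrix.mulVec_smul]; exact Submodule.smul_mem _ _ hx

theorem exists_grading : ∃ G : Grading (Fin κ → ℂ),
    (∀ t k v, C.σ t (G.proj k v) = (t : ℂ) ^ k • G.proj k v) ∧
      ∀ k v, C.IsWeight k v → ∀ l, G.proj l v = if l = k then v else 0 :=
  Grading.exists_of_weights (fun t => (C.σ t : (Fin κ → ℂ) →ₗ[ℂ] (Fin κ → ℂ))) C.span_weights

/-- The grading of `ℂ^κ` by the weights of `σ`. -/
def gr : Grading (Fin κ → ℂ) := C.exists_grading.choose

theorem isWeight_proj (k : ℤ) (w : Fin κ → ℂ) : C.IsWeight k (C.gr.proj k w) := fun t =>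
  C.exists_grading.choose_spec.1 t k w

variable {C} in
theorem IsWeight.proj {k : ℤ} {w : Fin κ → ℂ} (h : C.IsWeight k w) (l : ℤ) :
    C.gr.proj l w = if l = k then w else 0 :=
  C.exists_grading.choose_spec.2 k w h l

theorem proj_α₁ (k : ℤ) (w : Fin κ → ℂ) :
    C.gr.proj k (D.α₁ *ᵥ w) = D.α₁ *ᵥ C.gr.proj k w := by
  have := C.gr.proj_map C.gr D.α₁.mulVecLin 0 (fun k l v => by
    rw [Matrix.mulVecLin_apply, add_zero]
    exact (C.isWeight_proj l v).α₁.proj k) k w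
  rwa [add_zero] at this

theorem proj_α₂ (k : ℤ) (w : Fin κ → ℂ) :
    C.gr.proj (k - 2) (D.α₂ *ᵥ w) = D.α₂ *ᵥ C.gr.proj k w :=
  C.gr.proj_map C.gr D.α₂.mulVecLin (-2) (fun k l v => by
    rw [Matrix.mulVecLin_apply]
    exact (C.isWeight_proj l v).α₂.proj k) k w

theorem proj_b (k : ℤ) (r : Fin N → ℂ) :
    C.gr.proj (k - 2) (D.b *ᵥ r) = D.b *ᵥ (Grading.coord m).proj k r :=
  (Grading.coord m).proj_map C.gr D.b.mulVecLin (-2) (fun k l v => by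
    rw [Matrix.mulVecLin_apply]
    exact (C.isWeight_b fun j hj => by rw [Grading.coord_proj_apply, if_neg hj]).proj k) k r

theorem a_proj (k : ℤ) (w : Fin κ → ℂ) :
    (Grading.coord m).proj k (D.a *ᵥ w) = D.a *ᵥ C.gr.proj k w := by
  -- As before, t = 2 distinguishes the weights l and `m j`, so the coordinate must vanish.
  have hz : ∀ l v j, m j ≠ l → (D.a *ᵥ C.gr.proj l v) j = 0 := by
    intro l v j hj
    have h1 := C.a_σ (Units.mk0 2 two_ne_zero) (C.gr.proj l v) j
    rw [C.isWeight_proj l v, Matrix.mulVec_smul, Pi.smul_apply, smul_eq_mul, ← sub_eq_zero,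
      ← sub_mul, mul_eq_zero] at h1
    refine h1.resolve_left fun h2 => hj ?_
    have h3 : (2 : ℝ) ^ l = (2 : ℝ) ^ m j := by
      rw [sub_eq_zero] at h2
      simpa using congrArg norm h2
    exact (zpow_right_injective₀ (by norm_num) (by norm_num) h3).symm
  have := C.gr.proj_map (Grading.coord m) D.a.mulVecLin 0 (fun k l v => by
    funext j
    rw [Matrix.mulVecLin_apply, add_zero, Grading.coord_proj_apply]
    by_cases hk : k = l
    · rw [if_pos hk, ite_eq_left_iff]
      exact fun h => (hz l v j (hk ▸ h)).symm
    · rw [if_neg hk, Pi.zero_apply, ite_eq_right_iff]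
      exact fun h => hz l v j (h ▸ hk)) k w
  rwa [add_zero] at this

end CircleAction

/-! ### The filtration of the monad by weights -/

/-- The limit `(x, 0, z)` of `(x, c y, z)` as `c → 0`. -/
def limVec (X : Fin 3 → ℂ) : Fin 3 → ℂ := ![X 0, 0, X 2]

theorem limVec_ne_zero {X : Fin 3 → ℂ} : limVec X ≠ 0 ↔ ¬ (X 0 = 0 ∧ X 2 = 0) := by
  refine not_congr ⟨fun h => ⟨by simpa [limVec] using congrFun h 0, by
    simpa [limVec] using congrFun h 2⟩, fun h => ?_⟩
  funext i
  fin_cases i <;> simp [limVec, h]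

theorem ne_zero_of_limVec {X : Fin 3 → ℂ} (h : limVec X ≠ 0) : X ≠ 0 := by
  rintro rfl
  exact limVec_ne_zero.1 h ⟨rfl, rfl⟩

theorem limVec_eq_self {X : Fin 3 → ℂ} (h : X 1 = 0) : limVec X = X := by
  funext i
  fin_cases i <;> simp [limVec, h]

theorem limVec_rep_ne_zero (q : complMinus) : limVec q.1.rep ≠ 0 := limVec_ne_zero.2 q.2

namespace FramedMonad

variable {κ N : ℕ} (D : FramedMonad κ N)

theorem B_A (X : Fin 3 → ℂ) (w : Fin κ → ℂ) : D.B X (D.A X w) = 0 := by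
  have hadhm : D.α₁ *ᵥ D.α₂ *ᵥ w - D.α₂ *ᵥ D.α₁ *ᵥ w + D.b *ᵥ D.a *ᵥ w = 0 := by
    have := congrArg (fun M : Matrix (Fin κ) (Fin κ) ℂ => M *ᵥ w) D.adhm
    simpa [Matrix.add_mulVec, Matrix.sub_mulVec] using this
  rw [mapA_apply, mapB_apply]
  simp only [Matrix.mulVec_add, Matrix.mulVec_smul]
  rw [show D.b *ᵥ D.a *ᵥ w = D.α₂ *ᵥ D.α₁ *ᵥ w - D.α₁ *ᵥ D.α₂ *ᵥ w by
    rw [← sub_eq_zero, ← hadhm]; abel]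
  module

theorem im_le_ker (p : P2) : D.im p ≤ D.ker p := by
  rintro _ ⟨w, rfl⟩
  exact D.B_A _ w

theorem cls_eq_zero {p : P2} {v : Mid κ N} (hv : v ∈ D.ker p) :
    D.cls p ⟨v, hv⟩ = 0 ↔ v ∈ D.im p := by
  rw [Submodule.mkQ_apply, Submodule.Quotient.mk_eq_zero]
  rfl

theorem cls_eq_cls {p : P2} {v w : Mid κ N} (hv : v ∈ D.ker p) (hw : w ∈ D.ker p) :
    D.cls p ⟨v, hv⟩ = D.cls p ⟨w, hw⟩ ↔ v - w ∈ D.im p := by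
  rw [← sub_eq_zero, ← map_sub, ← D.cls_eq_zero (sub_mem hv hw)]
  rfl

theorem exists_cls {p : P2} (e : D.E p) : ∃ v, ∃ hv : v ∈ D.ker p, D.cls p ⟨v, hv⟩ = e := by
  obtain ⟨⟨v, hv⟩, rfl⟩ := Submodule.mkQ_surjective _ e
  exact ⟨v, hv, rfl⟩

end FramedMonad

namespace CircleAction

variable {κ N : ℕ} {D : FramedMonad κ N} {m : Fin N → ℤ} (C : CircleAction D m)

/-- The grading of the middle term of the monad by the weights of `ρ`. -/
def grK : Grading (Mid κ N) := C.gr.prod ((C.gr.shift 2).prod (Grading.coord m))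

theorem grK_proj (k : ℤ) (v : Mid κ N) : C.grK.proj k v =
    (C.gr.proj k v.1, C.gr.proj (k - 2) v.2.1, (Grading.coord m).proj k v.2.2) := rfl

theorem ρ_proj (t : ℂˣ) (k : ℤ) (v : Mid κ N) :
    C.ρ t (C.grK.proj k v) = (t : ℂ) ^ k • C.grK.proj k v := by
  rw [ρ_apply, grK_proj, Prod.smul_mk, Prod.smul_mk, C.isWeight_proj k, C.isWeight_proj (k - 2),
    smul_smul, zpow_sub₀ t.ne_zero, zpow_ofNat, mul_div_cancel₀ _ (pow_ne_zero _ t.ne_zero)]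
  refine Prod.ext rfl (Prod.ext rfl ?_)
  funext j
  simp only [Grading.coord_proj_apply, Pi.smul_apply, smul_eq_mul]
  split_ifs with h
  · rw [h]
  · simp

theorem proj_ρ (t : ℂˣ) (k : ℤ) (v : Mid κ N) :
    C.grK.proj k (C.ρ t v) = (t : ℂ) ^ k • C.grK.proj k v := by
  have := C.grK.proj_map C.grK (C.ρ t : Mid κ N →ₗ[ℂ] Mid κ N) 0 (fun k l v => by
    rw [LinearEquiv.coe_coe, C.ρ_proj, map_smul, C.grK.proj_proj, add_zero]
    split_ifs <;> simp) k v
  rw [add_zero] at this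
  exact this.trans (C.ρ_proj t k v)

theorem ρ_mem_filt (t : ℂˣ) {n : ℤ} {v : Mid κ N} (hv : v ∈ C.grK.filt n) :
    C.ρ t v ∈ C.grK.filt n :=
  C.grK.mem_filt.2 fun l hl => by rw [proj_ρ, C.grK.mem_filt.1 hv l hl, smul_zero]

/-- In the grading of K, whose second summand is shifted by 2, the x and z terms of $A_X$ have
degree 0 and the y term has degree 2. So the leading term of $A_X$ is $A$ at the limit point. -/
theorem proj_A (X : Fin 3 → ℂ) (k : ℤ) (w : Fin κ → ℂ) : C.grK.proj k (D.A X w) =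
    D.A (limVec X) (C.gr.proj k w) + (0, X 1 • C.gr.proj (k - 2) w, 0) := by
  rw [mapA_apply, mapA_apply, grK_proj]
  simp only [map_add, map_smul, proj_α₁, proj_α₂, C.a_proj, limVec]
  ext <;> simp [add_comm]

/-- Likewise the x and z terms of $B_X$ lower the degree by 2, while the y term preserves it and so
only affects higher steps. -/
theorem proj_B (X : Fin 3 → ℂ) (k : ℤ) (v : Mid κ N) : C.gr.proj (k - 2) (D.B X v) =
    D.B (limVec X) (C.grK.proj k v) - X 1 • C.gr.proj (k - 2) v.1 := by
  rw [mapB_apply, mapB_apply, grK_proj]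
  simp only [map_add, map_neg, map_smul, proj_α₁, proj_α₂, proj_b, limVec]
  ext
  simp
  ring

theorem A_mem_filt (X : Fin 3 → ℂ) {k : ℤ} {w : Fin κ → ℂ} (hw : w ∈ C.gr.filt k) :
    D.A X w ∈ C.grK.filt k := C.grK.mem_filt.2 fun l hl => by
  rw [proj_A, C.gr.mem_filt.1 hw l hl, C.gr.mem_filt.1 hw (l - 2) (by omega)]
  simp

theorem proj_A_of_mem (X : Fin 3 → ℂ) {k : ℤ} {w : Fin κ → ℂ} (hw : w ∈ C.gr.filt k) :
    C.grK.proj k (D.A X w) = D.A (limVec X) (C.gr.proj k w) := by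
  rw [proj_A, C.gr.mem_filt.1 hw (k - 2) (by omega)]
  simp

theorem mem_filt_grK {k : ℤ} {v : Mid κ N} : v ∈ C.grK.filt k ↔
    v.1 ∈ C.gr.filt k ∧ v.2.1 ∈ C.gr.filt (k - 2) ∧ v.2.2 ∈ (Grading.coord m).filt k := by
  rw [grK, Grading.filt_prod, Grading.filt_prod, Grading.filt_shift]
  rfl

theorem proj_B_of_mem (X : Fin 3 → ℂ) {k : ℤ} {v : Mid κ N} (hv : v ∈ C.grK.filt k) :
    C.gr.proj (k - 2) (D.B X v) = D.B (limVec X) (C.grK.proj k v) := by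
  rw [proj_B, C.gr.mem_filt.1 (C.mem_filt_grK.1 hv).1 (k - 2) (by omega), smul_zero, sub_zero]

theorem B_mem_filt (X : Fin 3 → ℂ) {k : ℤ} {v : Mid κ N} (hv : v ∈ C.grK.filt k) :
    D.B X v ∈ C.gr.filt (k - 2) := C.gr.mem_filt.2 fun l hl => by
  have := C.proj_B_of_mem X (C.grK.filt_anti (show l + 2 ≤ k by omega) hv)
  rw [add_sub_cancel_right] at this
  rw [this, C.grK.mem_filt.1 hv (l + 2) (by omega), map_zero]

/-- The monad map `B_X` is onto on every step of the filtration. -/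
theorem exists_B_eq {X : Fin 3 → ℂ} (hX : limVec X ≠ 0) (n : ℤ) :
    ∀ u ∈ C.gr.filt (n - 2), ∃ v ∈ C.grK.filt n, D.B X v = u := by
  -- The shifted grading is used so that the base case speaks of `filt (n - 2)`, where the target
  -- vectors live.
  refine (C.gr.shift 2).filt_induction_down
    (P := fun n => ∀ u ∈ C.gr.filt (n - 2), ∃ v ∈ C.grK.filt n, D.B X v = u) ?_ ?_ n
  · intro k hk u hu
    rw [Grading.filt_shift] at hk
    rw [hk, Submodule.mem_bot] at hu
    exact ⟨0, zero_mem _, by rw [hu, map_zero]⟩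
  · intro k ih u hu
    -- Surjectivity at the limit point solves the equation for the leading component; what is left
    -- lies one step deeper, where the induction hypothesis applies.
    obtain ⟨v₀, hv₀⟩ := D.surjective_B (limVec X) hX (C.gr.proj (k - 2) u)
    have h1 : C.grK.proj k v₀ ∈ C.grK.filt k := C.grK.proj_mem_filt le_rfl _
    have h2 : C.gr.proj (k - 2) (D.B X (C.grK.proj k v₀)) = C.gr.proj (k - 2) u := by
      have h3 := C.proj_B (limVec X) k v₀
      rw [hv₀, C.gr.proj_self, limVec_eq_self (X := limVec X) rfl] at h3
      rw [C.proj_B_of_mem X h1, C.grK.proj_self, h3]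
      simp [limVec]
    have h4 := C.gr.sub_mem_filt_succ hu (C.B_mem_filt X h1) h2
    rw [show k - 2 + 1 = k + 1 - 2 by ring] at h4
    obtain ⟨v, hv, hv'⟩ := ih _ h4
    exact ⟨v + C.grK.proj k v₀, add_mem (C.grK.filt_anti (by omega) hv) h1, by
      rw [map_add, hv', sub_add_cancel]⟩

/-- The monad map `A_X` is strict for the filtrations. -/
theorem mem_filt_of_A {X : Fin 3 → ℂ} (hX : limVec X ≠ 0) {n : ℤ} {w : Fin κ → ℂ}
    (h : D.A X w ∈ C.grK.filt n) : w ∈ C.gr.filt n := by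
  refine C.gr.filt_induction (P := fun k => w ∈ C.gr.filt k)
    (fun k hk => hk ▸ Submodule.mem_top) fun k hk hw => C.gr.mem_filt_succ hw ?_
  -- The lowest component of `w` is killed by $A$ at the limit point, hence is zero by injectivity
  -- there.
  apply D.injective_A (limVec X) hX
  rw [← C.proj_A_of_mem X hw, C.grK.mem_filt.1 h k hk, map_zero]

/-! ### The induced filtration of the cohomology bundle -/

/-- The classes in `E_p` of the elements of `ker B` that have only components of weight at least
`n`. -/
def filtE (n : ℤ) (p : P2) : Submodule ℂ (D.E p) :=
  ((C.grK.filt n).comap (D.ker p).subtype).map (D.cls p)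

theorem mem_filtE {n : ℤ} {p : P2} {e : D.E p} : e ∈ C.filtE n p ↔
    ∃ v ∈ C.grK.filt n, ∃ hv : v ∈ D.ker p, D.cls p ⟨v, hv⟩ = e := by
  constructor
  · rintro ⟨⟨v, hv⟩, h, rfl⟩
    exact ⟨v, h, hv, rfl⟩
  · rintro ⟨v, h, hv, rfl⟩
    exact ⟨⟨v, hv⟩, h, rfl⟩

theorem filtE_anti {k l : ℤ} (h : k ≤ l) (p : P2) : C.filtE l p ≤ C.filtE k p :=
  Submodule.map_mono (Submodule.comap_mono (C.grK.filt_anti h))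

/-- Rank-nullity for $B_X : F_nK → F_{n-2}$, which is onto. Since $F_nK$ is the sum of $F_n$,
$F_{n-2}$ and the coordinates of weight ≥ n, the terms $F_{n-2}$ cancel. -/
theorem finrank_ker_inf_filt {X : Fin 3 → ℂ} (hX : limVec X ≠ 0) (n : ℤ) :
    finrank ℂ (LinearMap.ker (D.B X) ⊓ C.grK.filt n : Submodule ℂ (Mid κ N)) =
      finrank ℂ (C.gr.filt n) + (Finset.univ.filter fun j => n ≤ m j).card := by
  have h := LinearMap.finrank_range_add_finrank_ker ((D.B X).domRestrict (C.grK.filt n))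
  have h1 : LinearMap.range ((D.B X).domRestrict (C.grK.filt n)) = C.gr.filt (n - 2) := by
    ext u
    constructor
    · rintro ⟨v, rfl⟩
      exact C.B_mem_filt X v.2
    · intro hu
      obtain ⟨v, hv, rfl⟩ := C.exists_B_eq hX n u hu
      exact ⟨⟨v, hv⟩, rfl⟩
  have h2 : finrank ℂ (LinearMap.ker ((D.B X).domRestrict (C.grK.filt n))) =
      finrank ℂ (LinearMap.ker (D.B X) ⊓ C.grK.filt n : Submodule ℂ (Mid κ N)) := by
    rw [← Submodule.finrank_map_subtype_eq, LinearMap.ker_domRestrict,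
      Submodule.map_comap_subtype, inf_comm]
  rw [h1, h2, grK, Grading.finrank_filt_prod, Grading.finrank_filt_prod, Grading.filt_shift,
    Grading.finrank_filt_coord] at h
  rw [grK]
  omega

/-- The rank of the part of `E_p` of weight at least `n`. -/
theorem finrank_filtE (n : ℤ) (q : complMinus) :
    finrank ℂ (C.filtE n q.1) = (Finset.univ.filter fun j => n ≤ m j).card := by
  have hX := limVec_rep_ne_zero q
  let Z : Submodule ℂ (Mid κ N) := D.ker q.1 ⊓ C.grK.filt n
  have hZ : finrank ℂ Z = _ := C.finrank_ker_inf_filt hX n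
  let f : Z →ₗ[ℂ] D.E q.1 := D.cls q.1 ∘ₗ Submodule.inclusion inf_le_left
  have h := LinearMap.finrank_range_add_finrank_ker f
  have h1 : LinearMap.range f = C.filtE n q.1 := by
    ext e
    rw [mem_filtE]
    constructor
    · rintro ⟨v, rfl⟩
      exact ⟨v.1, v.2.2, v.2.1, rfl⟩
    · rintro ⟨v, h, hv, rfl⟩
      exact ⟨⟨v, hv, h⟩, rfl⟩
  -- Strictness of `A`: an element of im A in the n-th step comes from the n-th step of ℂ^κ. So the
  -- kernel has a dimension independent of the point.
  have h2 : (LinearMap.ker f).map Z.subtype = (C.gr.filt n).map (D.A q.1.rep) := by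
    ext v
    constructor
    · rintro ⟨⟨v, hv⟩, hf, rfl⟩
      obtain ⟨w, rfl⟩ := (D.cls_eq_zero hv.1).1 hf
      exact ⟨w, C.mem_filt_of_A hX hv.2, rfl⟩
    · rintro ⟨w, hw, rfl⟩
      exact ⟨⟨_, D.B_A _ w, C.A_mem_filt _ hw⟩, (D.cls_eq_zero _).2 ⟨w, rfl⟩, rfl⟩
  have h3 : finrank ℂ (LinearMap.ker f) = finrank ℂ (C.gr.filt n) := by
    rw [← Submodule.finrank_map_subtype_eq, h2]
    exact (Submodule.equivMapOfInjective _ (D.injective_A _ q.1.rep_nonzero) _).symm.finrank_eq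
  rw [h1, h3, hZ] at h
  omega

theorem act_cls (t : ℂˣ) {p q : P2} (h : rot t p = q) {v : Mid κ N} (hv : v ∈ D.ker p) :
    C.act t h (D.cls p ⟨v, hv⟩) = D.cls q ⟨C.ρ t v, C.ρ_mem_ker t h v hv⟩ := rfl

theorem map_act_filtE_le (n : ℤ) (t : ℂˣ) {p q : P2} (h : rot t p = q) :
    (C.filtE n p).map (C.act t h) ≤ C.filtE n q := by
  rintro _ ⟨e, he, rfl⟩
  obtain ⟨v, hv, hk, rfl⟩ := C.mem_filtE.1 he
  exact C.mem_filtE.2 ⟨_, C.ρ_mem_filt t hv, C.ρ_mem_ker t h v hk, rfl⟩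

theorem act_injective (t : ℂˣ) {p q : P2} (h : rot t p = q) : Function.Injective (C.act t h) := by
  have h' : rot t⁻¹ q = p := by
    rw [← h, rot_eq_mk t p]
    conv_rhs => rw [← p.mk_rep]
    have : rotVec t⁻¹ (rotVec t p.rep) = p.rep := by
      funext i
      fin_cases i <;> simp [rotVec]
    simp only [rot, Projectivization.map_mk, this]
  rw [injective_iff_map_eq_zero]
  intro e he
  obtain ⟨v, hv, rfl⟩ := D.exists_cls e
  rw [act_cls, D.cls_eq_zero] at he
  rw [D.cls_eq_zero]
  have := C.ρ_mem_im t⁻¹ h' _ he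
  rwa [← LinearEquiv.mul_apply, ← map_mul, inv_mul_cancel, map_one] at this

theorem map_act_filtE (n : ℤ) (t : ℂˣ) (p q : complMinus) (h : rot t p.1 = q.1) :
    (C.filtE n p.1).map (C.act t h) = C.filtE n q.1 := by
  refine Submodule.eq_of_le_of_finrank_eq (C.map_act_filtE_le n t h) ?_
  rw [← (Submodule.equivMapOfInjective _ (C.act_injective t h) _).finrank_eq, finrank_filtE,
    finrank_filtE]

end CircleAction

namespace CircleAction

variable {κ N : ℕ} {D : FramedMonad κ N} {m : Fin N → ℤ} (C : CircleAction D m)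

/-! ### The fixed line -/

theorem mem_factor {j : Fin N} {p : P2} {hp : p ∈ linePlus} {e : D.E p} :
    e ∈ C.factor j p hp ↔
      ∀ t : ℂˣ, C.act t (rot_of_mem_linePlus t hp) e = (t : ℂ) ^ m j • e := by
  simp [factor, Submodule.mem_iInf, sub_eq_zero]

theorem limVec_rep_of_mem {p : P2} (hp : p ∈ linePlus) : limVec p.rep = p.rep :=
  limVec_eq_self hp

/-- When y = 0 the terms of $A$ and $B$ of higher degree vanish, so im A and ker B are graded
subspaces of K. -/
theorem proj_mem_im {p : P2} (hp : p ∈ linePlus) (k : ℤ) {v : Mid κ N} (hv : v ∈ D.im p) :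
    C.grK.proj k v ∈ D.im p := by
  obtain ⟨w, rfl⟩ := hv
  have hp' : p.rep 1 = 0 := hp
  rw [C.proj_A, limVec_rep_of_mem hp, hp', zero_smul]
  exact ⟨C.gr.proj k w, (add_zero _).symm⟩

theorem proj_mem_ker {p : P2} (hp : p ∈ linePlus) (k : ℤ) {v : Mid κ N} (hv : v ∈ D.ker p) :
    C.grK.proj k v ∈ D.ker p := by
  have h := C.proj_B p.rep k v
  have hp' : p.rep 1 = 0 := hp
  have hv' : D.B p.rep v = 0 := hv
  rw [hv', limVec_rep_of_mem hp, hp', zero_smul, sub_zero, map_zero] at h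
  exact h.symm

/-- If e is represented by v of weight ≥ k with k < `m j`, acting by t = 2 shows that (2 ^ k - 2 ^
`m j`) times the component $v_k$ lies in im A. Hence $v_k$ can be dropped from v without changing
the class. -/
theorem factor_le_filtE (j : Fin N) {p : P2} (hp : p ∈ linePlus) :
    C.factor j p hp ≤ C.filtE (m j) p := by
  intro e he
  rw [mem_factor] at he
  refine C.grK.filt_induction (P := fun k => e ∈ C.filtE k p) ?_ ?_
  · intro k hk
    obtain ⟨v, hv, rfl⟩ := D.exists_cls e
    exact C.mem_filtE.2 ⟨v, hk ▸ Submodule.mem_top, hv, rfl⟩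
  · intro k hk hek
    obtain ⟨v, hv, hvk, rfl⟩ := C.mem_filtE.1 hek
    have h1 := he (Units.mk0 2 two_ne_zero)
    rw [act_cls, ← map_smul] at h1
    have h2 := C.proj_mem_im hp k ((D.cls_eq_cls _ (Submodule.smul_mem _ _ hvk)).1 h1)
    rw [map_sub, map_smul, C.proj_ρ, ← sub_smul, Units.val_mk0] at h2
    have h3 : (2 : ℂ) ^ k - 2 ^ m j ≠ 0 := by
      intro h3
      have h4 : (2 : ℝ) ^ k = (2 : ℝ) ^ m j := by
        simpa using congrArg norm (sub_eq_zero.1 h3)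
      exact hk.ne (zpow_right_injective₀ (by norm_num) (by norm_num) h4)
    have h5 := (Submodule.smul_mem_iff _ h3).1 h2
    refine C.mem_filtE.2 ⟨v - C.grK.proj k v,
      C.grK.sub_mem_filt_succ hv (C.grK.proj_mem_filt le_rfl v) (C.grK.proj_self k v),
      sub_mem hvk (D.im_le_ker p h5), ?_⟩
    rw [D.cls_eq_cls _ hvk]
    simpa using h5

theorem filtE_le_iSup_factor (n : ℤ) {p : P2} (hp : p ∈ linePlus) :
    C.filtE n p ≤ ⨆ (j : Fin N) (_ : n ≤ m j), C.factor j p hp := by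
  refine C.grK.filt_induction_down
    (P := fun n => C.filtE n p ≤ ⨆ (j : Fin N) (_ : n ≤ m j), C.factor j p hp) ?_ ?_ n
  · intro k hk e he
    obtain ⟨v, hv, hvk, rfl⟩ := C.mem_filtE.1 he
    rw [hk, Submodule.mem_bot] at hv
    subst hv
    rw [show (⟨0, hvk⟩ : D.ker p) = 0 from rfl, map_zero]
    exact zero_mem _
  · intro k ih
    have ih' : C.filtE (k + 1) p ≤ ⨆ (j : Fin N) (_ : k ≤ m j), C.factor j p hp :=
      ih.trans (iSup_mono fun j => iSup_mono' fun h => ⟨by omega, le_rfl⟩)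
    by_cases hk : ∃ j, m j = k
    · obtain ⟨j, rfl⟩ := hk
      intro e he
      obtain ⟨v, hv, hvk, rfl⟩ := C.mem_filtE.1 he
      have hP := C.proj_mem_ker hp (m j) hvk
      have h1 : D.cls p ⟨v - C.grK.proj (m j) v, sub_mem hvk hP⟩ ∈ C.filtE (m j + 1) p :=
        C.mem_filtE.2 ⟨_, C.grK.sub_mem_filt_succ hv (C.grK.proj_mem_filt le_rfl v)
          (C.grK.proj_self _ v), _, rfl⟩
      have h2 : D.cls p ⟨C.grK.proj (m j) v, hP⟩ ∈ C.factor j p hp := by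
        rw [mem_factor]
        intro t
        rw [act_cls, ← map_smul]
        exact congrArg _ (Subtype.ext (C.ρ_proj t (m j) v))
      have h3 : D.cls p ⟨v, hvk⟩ = D.cls p ⟨v - C.grK.proj (m j) v, sub_mem hvk hP⟩ +
          D.cls p ⟨C.grK.proj (m j) v, hP⟩ := by
        rw [← map_add]
        exact congrArg _ (Subtype.ext (sub_add_cancel _ _).symm)
      rw [h3]
      exact add_mem (ih' h1) (Submodule.mem_iSup_of_mem j (Submodule.mem_iSup_of_mem le_rfl h2))
    -- If k is not a framing weight, the two steps have the same rank and there is nothing to split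
    -- off.
    · have h1 : C.filtE (k + 1) p = C.filtE k p := by
        refine Submodule.eq_of_le_of_finrank_eq (C.filtE_anti (by omega) p) ?_
        rw [C.finrank_filtE _ ⟨p, linePlus_subset_complMinus hp⟩,
          C.finrank_filtE _ ⟨p, linePlus_subset_complMinus hp⟩]
        congr 1
        refine Finset.filter_congr fun j _ => ?_
        have : m j ≠ k := fun h => hk ⟨j, h⟩
        omega
      exact h1 ▸ ih'

theorem filtE_eq_iSup_factor (n : ℤ) {p : P2} (hp : p ∈ linePlus) :
    C.filtE n p = ⨆ (j : Fin N) (_ : n ≤ m j), C.factor j p hp :=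
  le_antisymm (C.filtE_le_iSup_factor n hp) (iSup₂_le fun j hj =>
    (C.factor_le_filtE j hp).trans (C.filtE_anti hj p))

end CircleAction

/-! ### Closedness of sub-bundles -/

/-- The point of the complement of `[0 : 1 : 0]` with given homogeneous coordinates. -/
def pt (X : Fin 3 → ℂ) (hX : limVec X ≠ 0) : complMinus :=
  ⟨Projectivization.mk ℂ X (ne_zero_of_limVec hX), by
    obtain ⟨c, hc⟩ := Projectivization.exists_smul_eq_mk_rep ℂ X (ne_zero_of_limVec hX)
    rintro ⟨h0, h2⟩
    rw [← hc] at h0 h2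
    have k0 : (c : ℂ) * X 0 = 0 := h0
    have k2 : (c : ℂ) * X 2 = 0 := h2
    exact limVec_ne_zero.1 hX ⟨by simpa using k0, by simpa using k2⟩⟩

theorem tendsto_mk {V ι : Type*} [AddCommGroup V] [Module ℂ V] [TopologicalSpace V]
    {l : Filter ι} {X : ι → V} {Y : V} (hX : ∀ k, X k ≠ 0) (hY : Y ≠ 0)
    (h : Filter.Tendsto X l (𝓝 Y)) :
    Filter.Tendsto (fun k => Projectivization.mk ℂ (X k) (hX k)) l
      (𝓝 (Projectivization.mk ℂ Y hY)) := by
  have hc : Continuous (fun v : {v : V // v ≠ 0} => Projectivization.mk ℂ v.1 v.2) :=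
    continuous_quot_mk
  exact (hc.tendsto ⟨Y, hY⟩).comp
    (f := fun k => (⟨X k, hX k⟩ : {v : V // v ≠ 0})) (tendsto_subtype_rng.2 h)

theorem HolomorphicAt.tendsto {V F ι : Type*} [NormedAddCommGroup V] [NormedSpace ℂ V]
    [NormedAddCommGroup F] [NormedSpace ℂ F] {f : ℙ ℂ V → F} {p : ℙ ℂ V} (hf : HolomorphicAt f p)
    {l : Filter ι} {X : ι → V} (hX : ∀ k, X k ≠ 0) (h : Filter.Tendsto X l (𝓝 p.rep)) :
    Filter.Tendsto (fun k => f (Projectivization.mk ℂ (X k) (hX k))) l (𝓝 (f p)) := by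
  obtain ⟨g, hg, he⟩ := hf
  have h1 := hg.continuousAt.tendsto.comp h
  rw [he.self_of_nhds p.rep_nonzero, p.mk_rep] at h1
  refine h1.congr' ?_
  filter_upwards [h.eventually he] with k hk
  exact hk (hX k)

namespace FramedMonad

variable {κ N : ℕ} {D : FramedMonad κ N}

theorem continuous_A (D : FramedMonad κ N) (w : Fin κ → ℂ) : Continuous fun X => D.A X w := by
  simp only [mapA_apply]
  fun_prop

theorem continuous_B (D : FramedMonad κ N) :
    Continuous fun x : (Fin 3 → ℂ) × Mid κ N => D.B x.1 x.2 := by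
  simp only [mapB_apply]
  have h (n : ℕ) (M : Matrix (Fin κ) (Fin n) ℂ) : Continuous fun w : Fin n → ℂ => M *ᵥ w :=
    continuous_const.matrix_mulVec continuous_id
  have h1 := (h κ D.α₁).comp (continuous_fst.comp (continuous_snd.comp
    (continuous_snd (X := Fin 3 → ℂ) (Y := Mid κ N))))
  have h2 := (h κ D.α₂).comp (continuous_fst.comp
    (continuous_snd (X := Fin 3 → ℂ) (Y := Mid κ N)))
  have h3 := (h N D.b).comp (continuous_snd.comp (continuous_snd.comp
    (continuous_snd (X := Fin 3 → ℂ) (Y := Mid κ N))))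
  simp only [Function.comp_def] at h1 h2 h3
  fun_prop

theorem IsHolomorphicSubbundle.finrank_eq {r : ℕ} {L : ∀ q : complMinus, Submodule ℂ (D.E q)}
    (hL : D.IsHolomorphicSubbundle r L) (q : complMinus) : finrank ℂ (L q) = r := by
  obtain ⟨s, _, hs⟩ := hL q
  obtain ⟨_, hi, he⟩ := hs.self_of_nhds
  rw [← he, finrank_span_eq_card hi, Fintype.card_fin]

/-- Limits of vectors of a sub-bundle lie in the sub-bundle. -/
theorem IsHolomorphicSubbundle.mem_of_tendsto {r : ℕ}
    {L : ∀ q : complMinus, Submodule ℂ (D.E q)} (hL : D.IsHolomorphicSubbundle r L)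
    {X : ℕ → Fin 3 → ℂ} {Y : Fin 3 → ℂ} (hX : ∀ k, limVec (X k) ≠ 0) (hY : limVec Y ≠ 0)
    (hXY : Filter.Tendsto X Filter.atTop (𝓝 Y)) {u : ℕ → Mid κ N} {u₀ : Mid κ N}
    (hu : Filter.Tendsto u Filter.atTop (𝓝 u₀))
    (h : ∀ k, ∃ hk : u k ∈ D.ker (pt (X k) (hX k)).1, D.cls _ ⟨u k, hk⟩ ∈ L (pt (X k) (hX k))) :
    ∃ h₀ : u₀ ∈ D.ker (pt Y hY).1, D.cls _ ⟨u₀, h₀⟩ ∈ L (pt Y hY) := by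
  have hu₀ : u₀ ∈ D.ker (pt Y hY).1 := by
    rw [pt, D.ker_mk, LinearMap.mem_ker]
    refine tendsto_nhds_unique ((D.continuous_B.tendsto (Y, u₀)).comp (hXY.prodMk_nhds hu)) ?_
    refine tendsto_const_nhds.congr fun k => ?_
    obtain ⟨hk, _⟩ := h k
    rw [pt, D.ker_mk] at hk
    exact hk.symm
  refine ⟨hu₀, ?_⟩
  -- `HolomorphicAt` refers to the chosen representative of the limit point, so the sequence is
  -- rescaled to converge to it.
  obtain ⟨c, hc⟩ := Projectivization.exists_smul_eq_mk_rep ℂ Y (ne_zero_of_limVec hY)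
  have hc' : (c : ℂ) • Y = (pt Y hY).1.rep := hc
  have hcX : ∀ k, (c : ℂ) • X k ≠ 0 := fun k =>
    smul_ne_zero c.ne_zero (ne_zero_of_limVec (hX k))
  have hmk : ∀ k, Projectivization.mk ℂ ((c : ℂ) • X k) (hcX k) = (pt (X k) (hX k)).1 := fun k =>
    (Projectivization.mk_eq_mk_iff ℂ _ _ _ _).2 ⟨c, rfl⟩
  have hlim : Filter.Tendsto (fun k => (c : ℂ) • X k) Filter.atTop (𝓝 (pt Y hY).1.rep) :=
    hc' ▸ hXY.const_smul (c : ℂ)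
  obtain ⟨s, hs, hev⟩ := hL (pt Y hY)
  -- The quotient by im A is avoided by lifting to the fixed space K: the lifted frame of `L`
  -- together with the images under `A` of the standard basis spans the preimage of `L`.
  let F : ℕ → Fin r ⊕ Fin κ → Mid κ N := fun k =>
    Sum.elim (fun j => s j (pt (X k) (hX k)).1)
      (fun l => D.A ((c : ℂ) • X k) (Pi.basisFun ℂ (Fin κ) l))
  let F₀ : Fin r ⊕ Fin κ → Mid κ N :=
    Sum.elim (fun j => s j (pt Y hY).1) (fun l => D.A (pt Y hY).1.rep (Pi.basisFun ℂ (Fin κ) l))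
  have hF : Filter.Tendsto F Filter.atTop (𝓝 F₀) := by
    rw [tendsto_pi_nhds]
    rintro (j | l)
    · have := (hs j).tendsto hcX hlim
      simp only [hmk] at this
      exact this
    · exact ((D.continuous_A _).tendsto _).comp hlim
  have hrange : ∀ X' : Fin 3 → ℂ, LinearMap.range (D.A X') =
      Submodule.span ℂ (Set.range fun l => D.A X' (Pi.basisFun ℂ (Fin κ) l)) := fun X' => by
    rw [LinearMap.range_eq_map, ← (Pi.basisFun ℂ (Fin κ)).span_eq, Submodule.map_span,
      ← Set.range_comp]
    rfl
  obtain ⟨hsk, hi, he⟩ := hev.self_of_nhds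
  have hF₀ : LinearIndependent ℂ F₀ := by
    refine LinearIndependent.sum_type ?_ ?_ ?_
    · have h1 : LinearIndependent ℂ (fun j => (⟨s j (pt Y hY).1, hsk j⟩ : D.ker (pt Y hY).1)) :=
        LinearIndependent.of_comp (D.cls _) hi
      exact h1.map' (D.ker (pt Y hY).1).subtype (Submodule.ker_subtype _)
    · exact (Pi.basisFun ℂ (Fin κ)).linearIndependent.map' _
        (LinearMap.ker_eq_bot.2 (D.injective_A _ (pt Y hY).1.rep_nonzero))
    · rw [← hrange, Submodule.disjoint_def]
      intro v hv hvim
      obtain ⟨a, rfl⟩ := (Submodule.mem_span_range_iff_exists_fun ℂ).1 hv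
      have h1 : ∑ j, a j • D.cls (pt Y hY).1 ⟨s j (pt Y hY).1, hsk j⟩ = 0 := by
        simp only [← map_smul, ← map_sum]
        rw [← (D.cls_eq_zero (sum_mem fun j _ => Submodule.smul_mem _ _ (hsk j))).2 hvim]
        congr 1
        exact Subtype.ext (by simp)
      have h2 := Fintype.linearIndependent_iff.1 hi a h1
      simp [h2]
  by_contra hnot
  have hF₀' : u₀ ∉ Submodule.span ℂ (Set.range F₀) := by
    intro hmem
    apply hnot
    rw [Set.Sum.elim_range, Submodule.span_union, ← hrange] at hmem
    obtain ⟨v, hv, w, hw, rfl⟩ := Submodule.mem_sup.1 hmem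
    obtain ⟨a, rfl⟩ := (Submodule.mem_span_range_iff_exists_fun ℂ).1 hv
    rw [← he, Submodule.mem_span_range_iff_exists_fun]
    refine ⟨a, ?_⟩
    simp only [← map_smul, ← map_sum]
    have : (∑ j, a j • (⟨s j (pt Y hY).1, hsk j⟩ : D.ker (pt Y hY).1)) =
        ⟨∑ j, a j • s j (pt Y hY).1, sum_mem fun j _ => Submodule.smul_mem _ _ (hsk j)⟩ :=
      Subtype.ext (by simp)
    rw [this, D.cls_eq_cls, sub_add_cancel_left]
    exact neg_mem hw
  -- Linear independence is an open condition. If `u₀` were outside the limiting span, then `u k`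
  -- would be outside the nearby spans for large k, contrary to the hypothesis.
  have hopt := (linearIndependent_option'.2 ⟨hF₀, hF₀'⟩).eventually
  have htend : Filter.Tendsto (fun k => fun o : Option (Fin r ⊕ Fin κ) =>
      Option.casesOn' o (u k) (F k)) Filter.atTop
      (𝓝 fun o => Option.casesOn' o u₀ F₀) := by
    rw [tendsto_pi_nhds]
    rintro (_ | i)
    · exact hu
    · exact (tendsto_pi_nhds.1 hF) i
  have hpt : Filter.Tendsto (fun k => pt (X k) (hX k)) Filter.atTop (𝓝 (pt Y hY)) :=
    tendsto_subtype_rng.2 (tendsto_mk _ _ hXY)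
  obtain ⟨k, hk1, hk2⟩ := ((htend.eventually hopt).and (hpt.eventually hev)).exists
  obtain ⟨hsk', _, he'⟩ := hk2
  refine (linearIndependent_option'.1 hk1).2 ?_
  obtain ⟨huk, hmem⟩ := h k
  rw [← he', Submodule.mem_span_range_iff_exists_fun] at hmem
  obtain ⟨a, ha⟩ := hmem
  simp only [← map_smul, ← map_sum] at ha
  have : (∑ j, a j • (⟨s j (pt (X k) (hX k)).1, hsk' j⟩ : D.ker (pt (X k) (hX k)).1)) =
      ⟨∑ j, a j • s j (pt (X k) (hX k)).1, sum_mem fun j _ => Submodule.smul_mem _ _ (hsk' j)⟩ :=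
    Subtype.ext (by simp)
  rw [this, eq_comm, D.cls_eq_cls, ← hmk, D.im_mk, hrange] at ha
  rw [Set.Sum.elim_range, Submodule.span_union, hmk k |>.symm]
  refine Submodule.mem_sup.2 ⟨_, ?_, _, ha, add_sub_cancel _ _⟩
  rw [hmk]
  exact (Submodule.mem_span_range_iff_exists_fun ℂ).2 ⟨a, rfl⟩

end FramedMonad

/-! ### Uniqueness of the invariant sub-bundles -/

namespace CircleAction

variable {κ N : ℕ} {D : FramedMonad κ N} {m : Fin N → ℤ} (C : CircleAction D m)

/-- A vector of weight at least `k`, acted on by `t` and rescaled by `t ^ (-k)`, converges to its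
component of weight `k` as `t → 0`. -/
theorem tendsto_ρ {ι : Type*} {l : Filter ι} {t : ι → ℂˣ}
    (ht : Filter.Tendsto (fun i => (t i : ℂ)) l (𝓝 0)) {k : ℤ} {v : Mid κ N}
    (hv : v ∈ C.grK.filt k) :
    Filter.Tendsto (fun i => (t i : ℂ) ^ (-k) • C.ρ (t i) v) l (𝓝 (C.grK.proj k v)) := by
  have h1 : ∀ i, (t i : ℂ) ^ (-k) • C.ρ (t i) v =
      ∑ j ∈ C.grK.support, (t i : ℂ) ^ (j - k) • C.grK.proj j v := fun i => by
    conv_lhs => rw [← C.grK.sum_proj v, map_sum, Finset.smul_sum]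
    refine Finset.sum_congr rfl fun j _ => ?_
    rw [C.ρ_proj, smul_smul, ← zpow_add₀ (t i).ne_zero, neg_add_eq_sub]
  have h2 : C.grK.proj k v = ∑ j ∈ C.grK.support, C.grK.proj k (C.grK.proj j v) := by
    rw [← map_sum, C.grK.sum_proj]
  rw [h2]
  simp only [h1]
  refine tendsto_finsetSum _ fun j _ => ?_
  rw [C.grK.proj_proj]
  rcases lt_trichotomy j k with h | rfl | h
  · simpa [C.grK.mem_filt.1 hv j h] using tendsto_const_nhds
  · simpa using tendsto_const_nhds
  · rw [if_neg h.ne]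
    obtain ⟨d, hd⟩ := Int.eq_ofNat_of_zero_le (show 0 ≤ j - k - 1 by omega)
    have hd' : j - k = ((d + 1 : ℕ) : ℤ) := by push_cast; omega
    simp only [hd', zpow_natCast]
    have := (ht.pow (d + 1)).smul_const (C.grK.proj j v)
    simpa using this

theorem exists_units_tendsto : ∃ t : ℕ → ℂˣ,
    Filter.Tendsto (fun i => (t i : ℂ)) Filter.atTop (𝓝 0) := by
  refine ⟨fun i => Units.mk0 (1 / ((i : ℂ) + 1)) (one_div_ne_zero (Nat.cast_add_one_ne_zero i)), ?_⟩
  exact tendsto_one_div_add_atTop_nhds_zero_nat (𝕜 := ℂ)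

/-- Let v of weight ≥ k < n represent a vector of `L`. As t → 0, $t^{-k}ρ(t)v$ tends to $v_k$, whose
class at the limit point lies in `L` by closedness, hence in `filtE n`. Therefore $v_k =
A_{\lim}x_k$ for some $x_k$ of degree k, and v can be replaced by $v - A_Xx_k$, which has the same
class and weight ≥ k + 1. -/
theorem le_filtE {r : ℕ} {L : ∀ q : complMinus, Submodule ℂ (D.E q)}
    (hL : D.IsHolomorphicSubbundle r L)
    (hinv : ∀ (t : ℂˣ) (p q : complMinus) (h : rot t p.1 = q.1), (L p).map (C.act t h) ≤ L q)
    {n : ℤ} (hn : ∀ (p : P2) (hp : p ∈ linePlus),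
      L ⟨p, linePlus_subset_complMinus hp⟩ ≤ C.filtE n p) (q : complMinus) :
    L q ≤ C.filtE n q.1 := by
  intro e he
  refine C.grK.filt_induction (P := fun k => e ∈ C.filtE k q.1) ?_ ?_
  · intro k hk
    obtain ⟨v, hv, rfl⟩ := D.exists_cls e
    exact C.mem_filtE.2 ⟨v, hk ▸ Submodule.mem_top, hv, rfl⟩
  · intro k hk hek
    obtain ⟨v, hv, hvk, rfl⟩ := C.mem_filtE.1 hek
    obtain ⟨t, ht⟩ := exists_units_tendsto
    have hX := limVec_rep_ne_zero q
    have hlim : ∀ i, limVec (rotVec (t i) q.1.rep) ≠ 0 := fun i => hX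
    have hY : limVec (limVec q.1.rep) ≠ 0 := hX
    have htend : Filter.Tendsto (fun i => rotVec (t i) q.1.rep) Filter.atTop
        (𝓝 (limVec q.1.rep)) := by
      rw [tendsto_pi_nhds]
      intro j
      fin_cases j
      · exact tendsto_const_nhds
      · have := (ht.pow 2).mul_const (q.1.rep 1)
        rw [zero_pow two_ne_zero, zero_mul] at this
        exact this
      · exact tendsto_const_nhds
    obtain ⟨h₀, hmem⟩ := hL.mem_of_tendsto hlim hY htend (C.tendsto_ρ ht hv) fun i => by
      have hr : rot (t i) q.1 = (pt (rotVec (t i) q.1.rep) (hlim i)).1 := rot_eq_mk _ _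
      have h1 := hinv (t i) q _ hr (Submodule.mem_map_of_mem he)
      rw [C.act_cls] at h1
      refine ⟨Submodule.smul_mem _ _ (C.ρ_mem_ker _ hr _ hvk), ?_⟩
      exact Submodule.smul_mem _ ((t i : ℂ) ^ (-k)) h1
    have hp : (pt (limVec q.1.rep) hY).1 ∈ linePlus := by
      obtain ⟨c, hc⟩ := Projectivization.exists_smul_eq_mk_rep ℂ _ (ne_zero_of_limVec hY)
      change (pt (limVec q.1.rep) hY).1.rep 1 = 0
      rw [pt, ← hc]
      exact mul_zero _
    obtain ⟨w, hw, hwk, hwe⟩ := C.mem_filtE.1 (hn _ hp hmem)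
    rw [D.cls_eq_cls, pt, D.im_mk] at hwe
    obtain ⟨x, hx⟩ := hwe
    -- The representative `w` has weight ≥ n > k, so taking components of degree k leaves only the
    -- component of `v` and the image of a vector of degree k.
    have h2 := congrArg (C.grK.proj k) hx
    rw [map_sub, C.grK.proj_self, C.grK.mem_filt.1 hw k hk, C.proj_A] at h2
    simp only [limVec_eq_self (X := limVec q.1.rep) rfl] at h2
    have h3 : D.A (limVec q.1.rep) (C.gr.proj k (-x)) = C.grK.proj k v := by
      have h4 : limVec q.1.rep 1 = 0 := rfl
      rw [h4, zero_smul] at h2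
      rw [map_neg, map_neg, neg_eq_iff_eq_neg]
      rw [← h2.trans (zero_sub _)]
      exact (add_zero _).symm
    have hxk : C.gr.proj k (-x) ∈ C.gr.filt k := C.gr.proj_mem_filt le_rfl (-x)
    have h5 := C.A_mem_filt q.1.rep hxk
    have h6 := C.proj_A_of_mem q.1.rep hxk
    rw [C.gr.proj_self, h3] at h6
    have h7 : D.A q.1.rep (C.gr.proj k (-x)) ∈ D.im q.1 := ⟨_, rfl⟩
    refine C.mem_filtE.2 ⟨_, C.grK.sub_mem_filt_succ hv h5 h6, sub_mem hvk (D.im_le_ker _ h7), ?_⟩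
    rw [D.cls_eq_cls _ hvk]
    simpa using h7

/-- An invariant sub-bundle is determined by its restriction to the fixed line, if this is the part
of weight at least `n`. -/
theorem eq_filtE {L : ∀ q : complMinus, Submodule ℂ (D.E q)} {n : ℤ}
    (hL : D.IsHolomorphicSubbundle (Finset.univ.filter fun j => n ≤ m j).card L)
    (hinv : ∀ (t : ℂˣ) (p q : complMinus) (h : rot t p.1 = q.1), (L p).map (C.act t h) ≤ L q)
    (hn : ∀ (p : P2) (hp : p ∈ linePlus),
      L ⟨p, linePlus_subset_complMinus hp⟩ ≤ C.filtE n p) (q : complMinus) :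
    L q = C.filtE n q.1 :=
  Submodule.eq_of_le_of_finrank_eq (C.le_filtE hL hinv hn q)
    ((hL.finrank_eq q).trans (C.finrank_filtE n q).symm)

end CircleAction

/-! ### Homogeneous polynomial maps -/

/-- A map from `ℂ^n` to a vector space is homogeneous polynomial of degree `d` if its composition
with every linear functional is. -/
def HomPoly {n : ℕ} {V : Type*} [AddCommGroup V] [Module ℂ V] (d : ℕ) (f : (Fin n → ℂ) → V) :
    Prop :=
  ∀ φ : V →ₗ[ℂ] ℂ, ∃ p : MvPolynomial (Fin n) ℂ, p.IsHomogeneous d ∧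
    ∀ X, MvPolynomial.eval X p = φ (f X)

namespace HomPoly

variable {n d e : ℕ} {V W : Type*} [AddCommGroup V] [Module ℂ V] [AddCommGroup W] [Module ℂ W]
  {f g : (Fin n → ℂ) → V}

theorem const (v : V) : HomPoly 0 (fun _ : Fin n → ℂ => v) := fun φ =>
  ⟨MvPolynomial.C (φ v), MvPolynomial.isHomogeneous_C _ _, fun _ => MvPolynomial.eval_C _⟩

theorem linear (f : (Fin n → ℂ) →ₗ[ℂ] V) : HomPoly 1 f := fun φ => by
  refine ⟨∑ i, MvPolynomial.C (φ (f (Pi.single i 1))) * MvPolynomial.X i,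
    MvPolynomial.IsHomogeneous.sum _ _ _ fun i _ => MvPolynomial.isHomogeneous_C_mul_X _ i,
    fun X => ?_⟩
  conv_rhs => rw [← LinearMap.comp_apply, LinearMap.pi_apply_eq_sum_univ (φ ∘ₗ f) X]
  simp only [map_sum, map_mul, MvPolynomial.eval_C, MvPolynomial.eval_X, LinearMap.comp_apply,
    smul_eq_mul]
  refine Finset.sum_congr rfl fun i _ => ?_
  rw [mul_comm]
  congr 3
  funext j
  simp [Pi.single_apply, eq_comm]

theorem map (hf : HomPoly d f) (ψ : V →ₗ[ℂ] W) : HomPoly d fun X => ψ (f X) := fun φ =>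
  hf (φ ∘ₗ ψ)

theorem sub (hf : HomPoly d f) (hg : HomPoly d g) : HomPoly d fun X => f X - g X := fun φ => by
  obtain ⟨p, hp, hp'⟩ := hf φ
  obtain ⟨q, hq, hq'⟩ := hg φ
  exact ⟨p - q, hp.sub hq, fun X => by rw [map_sub, map_sub, hp', hq']⟩

theorem sum {ι : Type*} (s : Finset ι) {f : ι → (Fin n → ℂ) → V} (hf : ∀ i ∈ s, HomPoly d (f i)) :
    HomPoly d fun X => ∑ i ∈ s, f i X := fun φ => by
  choose! p hp hp' using fun i hi => hf i hi φ
  exact ⟨∑ i ∈ s, p i, MvPolynomial.IsHomogeneous.sum _ _ _ hp, fun X => by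
    rw [map_sum, map_sum]
    exact Finset.sum_congr rfl fun i hi => hp' i hi X⟩

theorem smul {c : (Fin n → ℂ) → ℂ} (hc : HomPoly e c) (hf : HomPoly d f) :
    HomPoly (e + d) fun X => c X • f X := fun φ => by
  obtain ⟨p, hp, hp'⟩ := hc LinearMap.id
  obtain ⟨q, hq, hq'⟩ := hf φ
  exact ⟨p * q, hp.mul hq, fun X => by rw [map_mul, map_smul, hp', hq']; rfl⟩

theorem prod {ι : Type*} (s : Finset ι) {c : ι → (Fin n → ℂ) → ℂ} {d : ι → ℕ}
    (hc : ∀ i ∈ s, HomPoly (d i) (c i)) : HomPoly (∑ i ∈ s, d i) fun X => ∏ i ∈ s, c i X := by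
  intro φ
  choose! p hp hp' using fun i hi => hc i hi LinearMap.id
  refine ⟨MvPolynomial.C (φ 1) * ∏ i ∈ s, p i,
    (MvPolynomial.IsHomogeneous.prod _ _ _ hp).C_mul _, fun X => ?_⟩
  have h : ∏ i ∈ s, MvPolynomial.eval X (p i) = ∏ i ∈ s, c i X :=
    Finset.prod_congr rfl fun i hi => hp' i hi X
  rw [map_mul, map_prod, h, MvPolynomial.eval_C, mul_comm, ← smul_eq_mul, ← map_smul, smul_eq_mul,
    mul_one]

theorem det {ι : Type*} [Fintype ι] [DecidableEq ι] {M : (Fin n → ℂ) → Matrix ι ι ℂ} {d : ι → ℕ}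
    (hM : ∀ i j, HomPoly (d i) fun X => M X i j) : HomPoly (∑ i, d i) fun X => (M X).det := by
  simp only [Matrix.det_apply]
  refine HomPoly.sum _ fun σ _ => ?_
  -- The term of σ is the product of the entries (σ i, i), of degrees `d (σ i)`.
  rw [← Equiv.sum_comp σ]
  have h := (HomPoly.prod Finset.univ fun i _ => hM (σ i) i).map
    (((Equiv.Perm.sign σ : ℤ) : ℂ) • LinearMap.id)
  simpa [Units.smul_def] using h

theorem adjugate {ι : Type*} [Fintype ι] [DecidableEq ι] {M : (Fin n → ℂ) → Matrix ι ι ℂ}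
    (hM : ∀ i j, HomPoly 1 fun X => M X i j) (i j : ι) :
    HomPoly (Fintype.card ι - 1) fun X => (M X).adjugate i j := by
  simp only [Matrix.adjugate_apply]
  -- An adjugate entry is a determinant in which row j is replaced by constants: degree 0 in that
  -- row and 1 in the others.
  have h : ∑ k, (if k = j then 0 else 1) = Fintype.card ι - 1 := by
    rw [Finset.sum_ite, Finset.sum_const_zero, zero_add, Finset.sum_const, smul_eq_mul, mul_one,
      Finset.filter_ne', Finset.card_erase_of_mem (Finset.mem_univ j), Finset.card_univ]
  rw [← h]
  refine HomPoly.det fun k l => ?_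
  by_cases hk : k = j
  · subst hk
    simpa using HomPoly.const _
  · simpa [hk, Matrix.updateRow_ne] using hM k l

theorem comp_linear {k : ℕ} (hf : HomPoly d f) (ℓ : (Fin k → ℂ) →ₗ[ℂ] (Fin n → ℂ)) :
    HomPoly d fun u => f (ℓ u) := fun φ => by
  obtain ⟨p, hp, hp'⟩ := hf φ
  choose q hq hq' using fun i => HomPoly.linear ℓ (LinearMap.proj i)
  refine ⟨MvPolynomial.bind₁ q p, ?_, fun u => ?_⟩
  · simpa using hp.aeval q hq
  · rw [← hp', MvPolynomial.eval, MvPolynomial.eval₂Hom_bind₁]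
    refine congrArg (fun x => MvPolynomial.eval x p) (funext fun i => ?_)
    exact hq' i u

theorem apply_smul [FiniteDimensional ℂ V] (hf : HomPoly d f) (c : ℂ) (X : Fin n → ℂ) :
    f (c • X) = c ^ d • f X := by
  rw [← sub_eq_zero, ← forall_dual_apply_eq_zero_iff ℂ]
  intro φ
  obtain ⟨p, hp, hp'⟩ := hf φ
  have h : MvPolynomial.eval (c • X) p = c ^ d * MvPolynomial.eval X p := by
    rw [MvPolynomial.eval_eq, MvPolynomial.eval_eq, Finset.mul_sum]
    refine Finset.sum_congr rfl fun s hs => ?_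
    rw [hp.degree_eq_sum_deg_support hs, ← Finset.prod_pow_eq_pow_sum]
    simp only [Pi.smul_apply, smul_eq_mul, mul_pow, Finset.prod_mul_distrib]
    ring
  rw [map_sub, map_smul, ← hp', ← hp', h, smul_eq_mul, sub_self]

theorem analyticAt {V : Type*} [NormedAddCommGroup V] [NormedSpace ℂ V] [FiniteDimensional ℂ V]
    {f : (Fin n → ℂ) → V} (hf : HomPoly d f) (X : Fin n → ℂ) : AnalyticAt ℂ f X := by
  let β := Module.finBasis ℂ V
  have h : f = fun X => ∑ i, β.coord i (f X) • β i := funext fun X => (β.sum_repr (f X)).symm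
  rw [h]
  refine Finset.analyticAt_fun_sum _ fun i _ => ?_
  obtain ⟨p, _, hp⟩ := hf (β.coord i)
  simp only [← hp]
  exact (AnalyticOnNhd.eval_mvPolynomial p X (Set.mem_univ X)).smul analyticAt_const

end HomPoly

/-! ### Polynomial frames -/

/-- The map π allows independence of a varying family to be tested by a determinant, as in the next
lemma. -/
theorem exists_dual_family {ι V : Type*} [Fintype ι] [DecidableEq ι] [AddCommGroup V] [Module ℂ V]
    {v : ι → V} (hv : LinearIndependent ℂ v) :
    ∃ π : V →ₗ[ℂ] (ι → ℂ), ∀ i, π (v i) = Pi.single i 1 := by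
  obtain ⟨π, hπ⟩ := (Fintype.linearCombination ℂ v).exists_leftInverse_of_injective
    (LinearMap.ker_eq_bot.2 (linearIndependent_iff_injective_fintypeLinearCombination.1 hv))
  refine ⟨π, fun i => ?_⟩
  have := congrArg (fun f : (ι → ℂ) →ₗ[ℂ] (ι → ℂ) => f (Pi.single i 1)) hπ
  simpa using this

/-- A polynomial family of vectors that is linearly independent at a point is so where a certain
homogeneous polynomial does not vanish. -/
theorem exists_homPoly_linearIndependent {n : ℕ} {ι V : Type*} [Fintype ι] [DecidableEq ι]
    [AddCommGroup V] [Module ℂ V] {d : ι → ℕ} {v : (Fin n → ℂ) → ι → V}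
    (hv : ∀ i, HomPoly (d i) fun X => v X i) {Y : Fin n → ℂ} (hY : LinearIndependent ℂ (v Y)) :
    ∃ g : (Fin n → ℂ) → ℂ, HomPoly (∑ i, d i) g ∧ g Y ≠ 0 ∧
      ∀ X, g X ≠ 0 → LinearIndependent ℂ (v X) := by
  obtain ⟨π, hπ⟩ := exists_dual_family hY
  refine ⟨fun X => (Matrix.of fun i => π (v X i)).det, HomPoly.det fun i j => ?_, ?_, ?_⟩
  · exact ((hv i).map π).map (LinearMap.proj j)
  · have : (Matrix.of fun i => π (v Y i)) = 1 := by
      ext i j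
      rw [Matrix.of_apply, hπ, Matrix.one_apply, Pi.single_apply]
      simp only [eq_comm]
    change (Matrix.of fun i => π (v Y i)).det ≠ 0
    rw [this, Matrix.det_one]
    exact one_ne_zero
  · intro X hX
    exact LinearIndependent.of_comp π (Matrix.linearIndependent_rows_of_det_ne_zero hX)

/-- `A_X w` as a linear map in `X`. -/
def mapALin {κ N : ℕ} (D : FramedMonad κ N) (w : Fin κ → ℂ) : (Fin 3 → ℂ) →ₗ[ℂ] Mid κ N where
  toFun X := D.A X w
  map_add' X Y := by
    simp only [mapA_apply, Pi.add_apply, add_smul]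
    ext <;> simp <;> ring
  map_smul' c X := by
    rw [D.A_smul]
    rfl

/-- `B_X v` as a linear map in `X`. -/
def mapBLin {κ N : ℕ} (D : FramedMonad κ N) (v : Mid κ N) : (Fin 3 → ℂ) →ₗ[ℂ] (Fin κ → ℂ) where
  toFun X := D.B X v
  map_add' X Y := by
    simp only [mapB_apply, Pi.add_apply, add_smul]
    abel
  map_smul' c X := by
    rw [D.B_smul]
    rfl

namespace CircleAction

variable {κ N : ℕ} {D : FramedMonad κ N} {m : Fin N → ℤ} (C : CircleAction D m)

/-- An element of a step of the filtration extends, up to a scalar polynomial, to a polynomial map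
with values in the kernel of `B`. -/
theorem exists_kernel_sections (n : ℤ) {Y : Fin 3 → ℂ} (hY : limVec Y ≠ 0) :
    ∃ (t : ℕ) (ρ : Fin t → Mid κ N) (g : (Fin 3 → ℂ) → ℂ), HomPoly t g ∧ g Y ≠ 0 ∧
      (∀ j, ρ j ∈ C.grK.filt n) ∧ LinearIndependent ℂ (fun j => D.B Y (ρ j)) ∧
      ∀ v ∈ C.grK.filt n, ∃ c : Fin t → (Fin 3 → ℂ) → ℂ, (∀ j, HomPoly t (c j)) ∧
        ∀ X, D.B X (g X • v - ∑ j, c j X • ρ j) = 0 := by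
  obtain ⟨t, ⟨τ⟩⟩ : ∃ t, Nonempty (Basis (Fin t) ℂ (C.gr.filt (n - 2))) :=
    ⟨_, ⟨Module.finBasis ℂ _⟩⟩
  have hex : ∀ j, ∃ v ∈ C.grK.filt n, D.B Y v = τ j := fun j => C.exists_B_eq hY n _ (τ j).2
  choose ρ hρ hρτ using hex
  have hτ : LinearIndependent ℂ fun j => (τ j : Fin κ → ℂ) :=
    τ.linearIndependent.map' (C.gr.filt (n - 2)).subtype (Submodule.ker_subtype _)
  obtain ⟨π, hπ⟩ := exists_dual_family hτ
  have hπinj : ∀ u ∈ C.gr.filt (n - 2), π u = 0 → u = 0 := by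
    intro u hu h
    have h1 : u = ∑ j, τ.repr ⟨u, hu⟩ j • (τ j : Fin κ → ℂ) := by
      have := congrArg Subtype.val (τ.sum_repr ⟨u, hu⟩)
      rw [AddSubmonoidClass.coe_finsetSum] at this
      exact this.symm
    have h2 : ∀ j, τ.repr ⟨u, hu⟩ j = 0 := by
      intro j
      have := congrFun h j
      rw [h1, map_sum] at this
      simpa [hπ, Pi.single_apply] using this
    rw [h1]
    simp [h2]
  -- Cramer's rule: `M X` is the matrix of the vectors $B_X ρ_j$ in coordinates that are faithful on
  -- $F_{n-2}$, with `M Y = 1`. With `g = det M` and coefficients adj(M) applied to $B_X v$, the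
  -- combination g v - ∑ c_j ρ_j is killed by $B_X$. Here ρ is a family of vectors, not the action.
  let M : (Fin 3 → ℂ) → Matrix (Fin t) (Fin t) ℂ :=
    fun X => Matrix.of fun i j => π (D.B X (ρ j)) i
  have hM : ∀ i j, HomPoly 1 fun X => M X i j := fun i j =>
    ((HomPoly.linear (mapBLin D (ρ j))).map π).map (LinearMap.proj i)
  refine ⟨t, ρ, fun X => (M X).det, ?_, ?_, hρ, ?_, ?_⟩
  · have h := HomPoly.det (d := fun _ => 1) hM
    rwa [Finset.sum_const, Finset.card_univ, Fintype.card_fin, smul_eq_mul, mul_one] at h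
  · have : M Y = 1 := by
      ext i j
      simp only [M, Matrix.of_apply, hρτ, hπ, Matrix.one_apply, Pi.single_apply]
    simp [this]
  · simpa only [hρτ] using hτ
  · intro v hv
    refine ⟨fun j X => ((M X).adjugate *ᵥ π (D.B X v)) j, fun j => ?_, fun X => ?_⟩
    · change HomPoly t fun X => ∑ i, (M X).adjugate j i * π (D.B X v) i
      refine HomPoly.sum _ fun i _ => ?_
      have h1 := (HomPoly.adjugate hM j i).smul
        (((HomPoly.linear (mapBLin D v)).map π).map (LinearMap.proj i))
      rw [Fintype.card_fin, Nat.sub_add_cancel (Fin.pos j)] at h1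
      exact h1
    · apply hπinj
      · exact C.B_mem_filt X (sub_mem (Submodule.smul_mem _ _ hv)
          (sum_mem fun j _ => Submodule.smul_mem _ _ (hρ j)))
      · have h1 : ∀ c : Fin t → ℂ,
            ∑ j, c j • π (D.B X (ρ j)) = M X *ᵥ c := by
          intro c
          funext i
          simp [M, Matrix.mulVec, dotProduct, mul_comm]
        simp only [map_sub, map_smul, map_sum]
        rw [h1, Matrix.mulVec_mulVec, Matrix.mul_adjugate, Matrix.smul_mulVec, Matrix.one_mulVec,
          sub_self]

/-- Near every point, the part of `E` of weight at least `n` has a frame of classes of homogeneous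
polynomial maps. -/
theorem exists_frame (n : ℤ) {r : ℕ} (hr : (Finset.univ.filter fun j => n ≤ m j).card = r)
    {Y : Fin 3 → ℂ} (hY : limVec Y ≠ 0) :
    ∃ (d e : ℕ) (g : (Fin 3 → ℂ) → ℂ) (s : Fin r → (Fin 3 → ℂ) → Mid κ N),
      HomPoly e g ∧ (∀ j, HomPoly d (s j)) ∧ g Y ≠ 0 ∧
      (∀ j X, s j X ∈ C.grK.filt n ∧ D.B X (s j X) = 0) ∧
      ∀ X, limVec X ≠ 0 → g X ≠ 0 → ∀ c : Fin r → ℂ,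
        ∑ j, c j • s j X ∈ LinearMap.range (D.A X) → c = 0 := by
  let β := Module.finBasisOfFinrankEq ℂ (C.filtE n (pt Y hY).1)
    ((C.finrank_filtE n (pt Y hY)).trans hr)
  choose s₀ hs₀ hs₀k hs₀β using fun j => C.mem_filtE.1 (β j).2
  have hker : ∀ v, v ∈ D.ker (pt Y hY).1 ↔ D.B Y v = 0 := fun v => by
    rw [pt, D.ker_mk, LinearMap.mem_ker]
  obtain ⟨t, ρ, g₂, hg₂, hg₂Y, hρ, hρB, hext⟩ := C.exists_kernel_sections n hY
  choose c hc hcB using fun j => hext (s₀ j) (hs₀ j)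
  let ω := Module.finBasis ℂ (C.gr.filt n)
  -- This family contains the corrections `ρ`, the image under $A_X$ of a basis of $F_n$, and the
  -- lifts `s₀` of a basis at Y. Its independence near Y rules out relations among the corrected
  -- sections modulo im A.
  let a : (Fin 3 → ℂ) → Fin t ⊕ Fin (finrank ℂ (C.gr.filt n)) ⊕ Fin r → Mid κ N := fun X =>
    Sum.elim ρ (Sum.elim (fun l => D.A X (ω l)) s₀)
  have ha : ∀ i, HomPoly (Sum.elim (fun _ => 0) (Sum.elim (fun _ => 1) (fun _ => 0)) i)
      fun X => a X i := by
    rintro (i | l | j)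
    · exact HomPoly.const _
    · exact HomPoly.linear (mapALin D (ω l))
    · exact HomPoly.const _
  have haY : LinearIndependent ℂ (a Y) := by
    rw [Fintype.linearIndependent_iff]
    intro x hx
    simp only [Fintype.sum_sum_type, a, Sum.elim_inl, Sum.elim_inr] at hx
    -- The coefficients are eliminated in turn: by applying $B_Y$, then by passing to classes modulo
    -- im A, then by injectivity of $A_Y$.
    have h1 : ∀ i, x (Sum.inl i) = 0 := by
      apply Fintype.linearIndependent_iff.1 hρB
      have := congrArg (D.B Y) hx
      simp only [map_add, map_sum, map_smul, D.B_A, smul_zero, Finset.sum_const_zero,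
        (hker _).1 (hs₀k _), add_zero, map_zero] at this
      exact this
    simp only [h1, zero_smul, Finset.sum_const_zero, zero_add] at hx
    have h2 : ∀ j, x (Sum.inr (Sum.inr j)) = 0 := by
      apply Fintype.linearIndependent_iff.1 β.linearIndependent
      apply Subtype.ext
      simp only [AddSubmonoidClass.coe_finsetSum, SetLike.val_smul, ← hs₀β, ZeroMemClass.coe_zero]
      simp only [← map_smul, ← map_sum]
      have hmem : ∑ j, x (Sum.inr (Sum.inr j)) • s₀ j ∈ D.im (pt Y hY).1 := by
        rw [pt, D.im_mk, eq_neg_of_add_eq_zero_right hx]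
        exact neg_mem (sum_mem fun l _ => Submodule.smul_mem _ _ ⟨_, rfl⟩)
      rw [← (D.cls_eq_zero (D.im_le_ker _ hmem)).2 hmem]
      congr 1
      exact Subtype.ext (by simp)
    simp only [h2, zero_smul, Finset.sum_const_zero, add_zero] at hx
    have h3 : ∀ l, x (Sum.inr (Sum.inl l)) = 0 := by
      apply Fintype.linearIndependent_iff.1 ω.linearIndependent
      apply Subtype.ext
      apply D.injective_A Y (ne_zero_of_limVec hY)
      simpa using hx
    rintro (i | l | j)
    exacts [h1 i, h3 l, h2 j]
  obtain ⟨g₁, hg₁, hg₁Y, hg₁X⟩ := exists_homPoly_linearIndependent ha haY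
  refine ⟨t, _, fun X => g₁ X • g₂ X, fun j X => g₂ X • s₀ j - ∑ i, c j i X • ρ i, hg₁.smul hg₂,
    fun j => ?_, mul_ne_zero hg₁Y hg₂Y, fun j X => ⟨?_, hcB j X⟩, ?_⟩
  · have h1 := hg₂.smul (HomPoly.const (s₀ j))
    exact h1.sub (HomPoly.sum _ fun i _ => (hc j i).smul (HomPoly.const (ρ i)))
  · exact sub_mem (Submodule.smul_mem _ _ (hs₀ j))
      (sum_mem fun i _ => Submodule.smul_mem _ _ (hρ i))
  · rintro X hX hgX y ⟨w, hw⟩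
    -- Strictness puts `w` in $F_n$, so the basis `ω` of $F_n$ suffices to express $A_X w$.
    have hw' : w ∈ C.gr.filt n := by
      apply C.mem_filt_of_A hX
      rw [hw]
      exact sum_mem fun j _ => Submodule.smul_mem _ _ (sub_mem (Submodule.smul_mem _ _ (hs₀ j))
        (sum_mem fun i _ => Submodule.smul_mem _ _ (hρ i)))
    have hwω : D.A X w = ∑ l, ω.repr ⟨w, hw'⟩ l • D.A X (ω l) := by
      have := congrArg Subtype.val (ω.sum_repr ⟨w, hw'⟩)
      rw [AddSubmonoidClass.coe_finsetSum] at this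
      refine (congrArg (D.A X) this.symm).trans ?_
      rw [map_sum]
      exact Finset.sum_congr rfl fun l _ => map_smul _ _ _
    -- The relation is rewritten in the family `a X`; the coefficient of `s₀ j` becomes `y j * g₂
    -- X`, and `g₂ X` is nonzero.
    have h1 := Fintype.linearIndependent_iff.1 (hg₁X X (left_ne_zero_of_mul hgX))
      (Sum.elim (fun i => -∑ j, y j * c j i X)
        (Sum.elim (fun l => -ω.repr ⟨w, hw'⟩ l) (fun j => y j * g₂ X))) (by
        simp only [Fintype.sum_sum_type, a, Sum.elim_inl, Sum.elim_inr, neg_smul,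
          Finset.sum_neg_distrib]
        rw [← hwω, hw]
        simp only [smul_sub, Finset.sum_sub_distrib, smul_smul, Finset.smul_sum, Finset.sum_smul]
        rw [Finset.sum_comm]
        abel)
    funext j
    exact (mul_eq_zero.1 (h1 (Sum.inr (Sum.inr j)))).resolve_right (right_ne_zero_of_mul hgX)

/-- Dividing the polynomial frame of degree d by the d-th power of a coordinate that is nonzero at p
makes it homogeneous of degree 0, hence a function on the plane. Constancy of rank upgrades r
independent sections to a frame. -/
theorem isHolomorphicSubbundle_filtE (n : ℤ) {r : ℕ}
    (hr : (Finset.univ.filter fun j => n ≤ m j).card = r) :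
    D.IsHolomorphicSubbundle r fun q => C.filtE n q.1 := by
  intro p
  obtain ⟨d, e, g, s, hg, hs, hgp, hsk, hind⟩ := C.exists_frame n hr (limVec_rep_ne_zero p)
  obtain ⟨i, hi⟩ : ∃ i, p.1.rep i ≠ 0 := by
    by_contra! h
    exact p.1.rep_nonzero (funext h)
  refine ⟨fun j q => (q.rep i ^ d)⁻¹ • s j q.rep, fun j => ?_, ?_⟩
  · refine ⟨fun X => (X i ^ d)⁻¹ • s j X, ?_, ?_⟩
    · have h1 : AnalyticAt ℂ (fun X : Fin 3 → ℂ => X i ^ d) p.1.rep :=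
        ((ContinuousLinearMap.proj (R := ℂ) (φ := fun _ : Fin 3 => ℂ) i).analyticAt _).pow d
      exact (h1.inv (pow_ne_zero _ hi)).smul ((hs j).analyticAt _)
    · refine Filter.Eventually.of_forall fun X hX => ?_
      obtain ⟨c, hc⟩ := Projectivization.exists_smul_eq_mk_rep ℂ X hX
      have hc' : (c : ℂ) • X = (Projectivization.mk ℂ X hX).rep := hc
      change (X i ^ d)⁻¹ • s j X = ((Projectivization.mk ℂ X hX).rep i ^ d)⁻¹ •
        s j (Projectivization.mk ℂ X hX).rep
      rw [← hc', (hs j).apply_smul, smul_smul, Pi.smul_apply, smul_eq_mul, mul_pow, mul_inv,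
        mul_right_comm, inv_mul_cancel₀ (pow_ne_zero _ c.ne_zero), one_mul]
  -- Both conditions are unchanged by rescaling, so openness can be checked on the punctured cone.
  · have hU : IsOpen {q : P2 | g q.rep ≠ 0 ∧ q.rep i ≠ 0} := by
      have hq : Topology.IsQuotientMap
          (fun v : {v : Fin 3 → ℂ // v ≠ 0} => Projectivization.mk ℂ v.1 v.2) :=
        isQuotientMap_quot_mk
      rw [← hq.isOpen_preimage]
      have : ((fun v : {v : Fin 3 → ℂ // v ≠ 0} => Projectivization.mk ℂ v.1 v.2) ⁻¹'
          {q : P2 | g q.rep ≠ 0 ∧ q.rep i ≠ 0}) = {X | g X.1 ≠ 0 ∧ X.1 i ≠ 0} := by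
        ext X
        obtain ⟨c, hc⟩ := Projectivization.exists_smul_eq_mk_rep ℂ X.1 X.2
        have hc' : (c : ℂ) • X.1 = (Projectivization.mk ℂ X.1 X.2).rep := hc
        rw [Set.mem_preimage, Set.mem_ofPred_eq, Set.mem_ofPred_eq, ← hc', hg.apply_smul]
        simp
      rw [this]
      have hgc : Continuous g :=
        continuous_iff_continuousAt.2 fun X => (hg.analyticAt X).continuousAt
      exact ((isOpen_ne_fun hgc continuous_const).inter
        (isOpen_ne_fun (continuous_apply i) continuous_const)).preimage continuous_subtype_val
    filter_upwards [(hU.preimage continuous_subtype_val).mem_nhds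
      (show p ∈ Subtype.val ⁻¹' {q : P2 | g q.rep ≠ 0 ∧ q.rep i ≠ 0} from ⟨hgp, hi⟩)] with q hq
    have hk : ∀ j, (q.1.rep i ^ d)⁻¹ • s j q.1.rep ∈ D.ker q.1 := fun j =>
      Submodule.smul_mem _ _ (hsk j _).2
    have hli : LinearIndependent ℂ fun j => D.cls q.1 ⟨(q.1.rep i ^ d)⁻¹ • s j q.1.rep, hk j⟩ := by
      rw [Fintype.linearIndependent_iff]
      intro y hy
      simp only [← map_smul, ← map_sum] at hy
      have h1 : (∑ j, y j • (⟨(q.1.rep i ^ d)⁻¹ • s j q.1.rep, hk j⟩ : D.ker q.1)) =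
          ⟨∑ j, (y j * (q.1.rep i ^ d)⁻¹) • s j q.1.rep,
            sum_mem fun j _ => Submodule.smul_mem _ _ (hsk j _).2⟩ :=
        Subtype.ext (by simp [smul_smul])
      rw [h1, D.cls_eq_zero] at hy
      have h2 := hind _ (limVec_rep_ne_zero q) hq.1 _ hy
      intro j
      exact (mul_eq_zero.1 (congrFun h2 j)).resolve_right (inv_ne_zero (pow_ne_zero _ hq.2))
    refine ⟨hk, hli, Submodule.eq_of_le_of_finrank_eq ?_ ?_⟩
    · rw [Submodule.span_le]
      rintro _ ⟨j, rfl⟩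
      exact C.mem_filtE.2 ⟨_, Submodule.smul_mem _ _ (hsk j _).1, hk j, rfl⟩
    · rw [finrank_span_eq_card hli, Fintype.card_fin, C.finrank_filtE, hr]

end CircleAction

/-! ### The framing on the horosphere lines -/

theorem horoVec_ne_zero (h : ℂ) {u : Fin 2 → ℂ} (hu : u ≠ 0) : horoVec h u ≠ 0 := fun e =>
  hu (horoVec_injective h (by rw [e, map_zero]))

theorem limVec_horoVec_ne_zero (h : ℂ) {u : Fin 2 → ℂ} (hu : u ≠ 0) :
    limVec (horoVec h u) ≠ 0 := by
  rw [limVec_ne_zero]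
  rintro ⟨h0, h1⟩
  apply hu
  funext i
  fin_cases i
  · exact h0
  · exact h1

theorem horoPoint_mk (h : ℂ) {u : Fin 2 → ℂ} (hu : u ≠ 0) :
    horoPoint h (Projectivization.mk ℂ u hu) =
      Projectivization.mk ℂ (horoVec h u) (horoVec_ne_zero h hu) := rfl

theorem horoPoint_rep (h : ℂ) (u : P1) :
    (horoPoint h u).rep 1 = -h * (horoPoint h u).rep 2 := by
  have e : horoPoint h u = Projectivization.mk ℂ (horoVec h u.rep)
      (horoVec_ne_zero h u.rep_nonzero) := by
    conv_lhs => rw [← u.mk_rep]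
    rfl
  obtain ⟨c, hc⟩ := Projectivization.exists_smul_eq_mk_rep ℂ (horoVec h u.rep)
    (horoVec_ne_zero h u.rep_nonzero)
  rw [← e] at hc
  rw [← hc]
  change (c : ℂ) * (-h * u.rep 1) = -h * ((c : ℂ) * u.rep 1)
  ring

namespace CircleAction

variable {κ N : ℕ} {D : FramedMonad κ N} {m : Fin N → ℤ} (C : CircleAction D m)

/-- `α₂` lowers degrees by 2 in a finite grading, so it is nilpotent and has no nonzero eigenvalue;
the components of `w` vanish from the top degree down. -/
theorem eq_zero_of_α₂_eq_smul (C : CircleAction D m) {h : ℂ} (hh : h ≠ 0) {w : Fin κ → ℂ}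
    (hw : D.α₂ *ᵥ w = h • w) :
    w = 0 := by
  refine C.gr.eq_zero_of_proj fun k => ?_
  refine C.gr.filt_induction_down (P := fun k => ∀ l ≥ k, C.gr.proj l w = 0) ?_ ?_ k k le_rfl
  · intro k hk l hl
    have := C.gr.proj_mem_filt hl w
    rwa [hk, Submodule.mem_bot] at this
  · intro k ih l hl
    rcases hl.eq_or_lt with rfl | hl
    · have h1 := C.proj_α₂ (k + 2) w
      rw [ih (k + 2) (by omega), add_sub_cancel_right, hw, map_smul, Matrix.mulVec_zero] at h1
      exact (smul_eq_zero.1 h1).resolve_left hh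
    · exact ih l hl

/-- The automorphism `α₂ - h` of `ℂ^κ`, for `h ≠ 0`. -/
def subEquiv {h : ℂ} (hh : h ≠ 0) : (Fin κ → ℂ) ≃ₗ[ℂ] (Fin κ → ℂ) :=
  LinearEquiv.ofInjectiveEndo (D.α₂.mulVecLin - h • LinearMap.id) <| by
    rw [injective_iff_map_eq_zero]
    intro w hw
    exact C.eq_zero_of_α₂_eq_smul hh (sub_eq_zero.1 hw)

theorem subEquiv_apply {h : ℂ} (hh : h ≠ 0) (w : Fin κ → ℂ) :
    C.subEquiv hh w = D.α₂ *ᵥ w - h • w := rfl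

/-- The map `(v₁, v₂, r) ↦ r - a (α₂ - h)⁻¹ v₂`, which on the line `y = -h z` induces the
identification of the fibres of `E` with `ℂ^N`. -/
def readK {h : ℂ} (hh : h ≠ 0) : Mid κ N →ₗ[ℂ] (Fin N → ℂ) :=
  LinearMap.snd ℂ _ _ ∘ₗ LinearMap.snd ℂ _ _ -
    D.a.mulVecLin ∘ₗ (C.subEquiv hh).symm.toLinearMap ∘ₗ LinearMap.fst ℂ _ _ ∘ₗ LinearMap.snd ℂ _ _

theorem readK_apply {h : ℂ} (hh : h ≠ 0) (v : Mid κ N) :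
    C.readK hh v = v.2.2 - D.a *ᵥ (C.subEquiv hh).symm v.2.1 := rfl

/-- On the line y = -hz the last two components of $A_X w$ are z(α₂ - h)w and z a w, which `readK`
cancels. So `readK` descends to the fibres of E. -/
theorem readK_A {h : ℂ} (hh : h ≠ 0) {X : Fin 3 → ℂ} (hX : X 1 = -h * X 2) (w : Fin κ → ℂ) :
    C.readK hh (D.A X w) = 0 := by
  have h1 : X 1 • w + X 2 • D.α₂ *ᵥ w = X 2 • C.subEquiv hh w := by
    rw [hX, subEquiv_apply]
    module
  rw [readK_apply, mapA_apply]
  simp only [h1, map_smul, LinearEquiv.symm_apply_apply, Matrix.mulVec_smul, sub_self]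

/-- For z ≠ 0 the vector $w = z^{-1}(α_2 - h)^{-1}v_2$ matches the last two components of v, and
applying $B_X$ to $v - A_Xw$ forces the first to match, as z(α₂ - h) is invertible. For z = 0 also y
= 0, and $B_X v = x v_2$ makes the claim immediate. -/
theorem mem_range_A {h : ℂ} (hh : h ≠ 0) {X : Fin 3 → ℂ} (hX : X 1 = -h * X 2)
    (hX0 : limVec X ≠ 0) {v : Mid κ N} (hv : D.B X v = 0) (hr : C.readK hh v = 0) :
    v ∈ LinearMap.range (D.A X) := by
  by_cases hz : X 2 = 0
  · have hx : X 0 ≠ 0 := fun hx => limVec_ne_zero.1 hX0 ⟨hx, hz⟩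
    rw [hz, mul_zero] at hX
    rw [mapB_apply, hX, hz] at hv
    simp only [zero_smul, add_zero, neg_zero, zero_add] at hv
    have h2 := (smul_eq_zero.1 hv).resolve_left hx
    rw [readK_apply, h2, map_zero, Matrix.mulVec_zero, sub_zero] at hr
    refine ⟨(X 0)⁻¹ • v.1, ?_⟩
    rw [mapA_apply, hX, hz]
    refine Prod.ext ?_ (Prod.ext ?_ ?_)
    · simp [smul_smul, hx]
    · simp [h2]
    · simp [hr]
  · set w := (X 2)⁻¹ • (C.subEquiv hh).symm v.2.1 with hw
    have hα : D.α₂ *ᵥ w = (X 2)⁻¹ • v.2.1 + h • w := by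
      rw [← sub_eq_iff_eq_add, ← C.subEquiv_apply hh, hw, map_smul, LinearEquiv.apply_symm_apply]
    have ha : X 2 • D.a *ᵥ w = v.2.2 := by
      rw [hw, Matrix.mulVec_smul, smul_smul, mul_inv_cancel₀ hz, one_smul]
      exact (sub_eq_zero.1 hr).symm
    have h2 : (D.A X w).2 = v.2 := by
      rw [mapA_apply]
      refine Prod.ext ?_ ha
      change X 1 • w + X 2 • D.α₂ *ᵥ w = v.2.1
      rw [hα, hX, smul_add, smul_smul _ _ v.2.1, mul_inv_cancel₀ hz]
      module
    refine ⟨w, Prod.ext ?_ h2⟩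
    have h3 : D.B X (v - D.A X w) = 0 := by rw [map_sub, hv, D.B_A, sub_zero]
    rw [mapB_apply, Prod.snd_sub, h2, sub_self] at h3
    simp only [Prod.fst_zero, Prod.snd_zero, Matrix.mulVec_zero, smul_zero, add_zero,
      neg_eq_zero] at h3
    have h4 : X 1 • (v - D.A X w).1 + X 2 • D.α₂ *ᵥ (v - D.A X w).1 =
        X 2 • C.subEquiv hh (v - D.A X w).1 := by
      rw [hX, subEquiv_apply]
      module
    rw [h4] at h3
    have h5 := (C.subEquiv hh).map_eq_zero_iff.1 ((smul_eq_zero.1 h3).resolve_left hz)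
    exact (sub_eq_zero.1 h5).symm

theorem B_lift {h : ℂ} (hh : h ≠ 0) {X : Fin 3 → ℂ} (hX : X 1 = -h * X 2) (r : Fin N → ℂ) :
    D.B X ((C.subEquiv hh).symm (D.b *ᵥ r), 0, r) = 0 := by
  have h1 := (C.subEquiv hh).apply_symm_apply (D.b *ᵥ r)
  rw [subEquiv_apply, sub_eq_iff_eq_add] at h1
  rw [mapB_apply]
  simp only [h1, hX, Matrix.mulVec_zero, smul_zero, zero_add]
  module

/-- The identification of a fibre of `E` on the line `y = -h z` with `ℂ^N`. -/
def readE {h : ℂ} (hh : h ≠ 0) {p : P2} (hp : p.rep 1 = -h * p.rep 2) : D.E p →ₗ[ℂ] (Fin N → ℂ) :=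
  ((D.im p).submoduleOf (D.ker p)).liftQ (C.readK hh ∘ₗ (D.ker p).subtype) <| by
    rintro ⟨_, _⟩ ⟨w, rfl⟩
    exact C.readK_A hh hp w

theorem readE_cls {h : ℂ} (hh : h ≠ 0) {p : P2} (hp : p.rep 1 = -h * p.rep 2) {v : Mid κ N}
    (hv : v ∈ D.ker p) : C.readE hh hp (D.cls p ⟨v, hv⟩) = C.readK hh v := rfl

theorem readE_injective {h : ℂ} (hh : h ≠ 0) {p : P2} (hp : p.rep 1 = -h * p.rep 2)
    (hpm : p ∈ complMinus) : Function.Injective (C.readE hh hp) := by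
  rw [injective_iff_map_eq_zero]
  intro e he
  obtain ⟨v, hv, rfl⟩ := D.exists_cls e
  exact (D.cls_eq_zero hv).2 (C.mem_range_A hh hp (limVec_rep_ne_zero ⟨p, hpm⟩) hv he)

theorem exists_frames (C : CircleAction D m) {h : ℂ} (hh : h ≠ 0) {p : P2}
    (hp : p.rep 1 = -h * p.rep 2) (r : Fin N → ℂ) : ∃ e, D.Frames p r e :=
  ⟨_, _, C.B_lift hh hp r, rfl⟩

theorem readE_of_frames {h : ℂ} (hh : h ≠ 0) {p : P2} (hp : p.rep 1 = -h * p.rep 2)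
    {r : Fin N → ℂ} {e : D.E p} (he : D.Frames p r e) : C.readE hh hp e = r := by
  obtain ⟨v, hv, rfl⟩ := he
  rw [readE_cls, readK_apply, map_zero, Matrix.mulVec_zero, sub_zero]

theorem frames_iff {h : ℂ} (hh : h ≠ 0) {p : P2} (hp : p.rep 1 = -h * p.rep 2)
    (hpm : p ∈ complMinus) (r : Fin N → ℂ) (e : D.E p) :
    D.Frames p r e ↔ C.readE hh hp e = r := by
  refine ⟨C.readE_of_frames hh hp, fun he => ?_⟩
  obtain ⟨e', he'⟩ := C.exists_frames hh hp r
  rwa [C.readE_injective hh hp hpm (he.trans (C.readE_of_frames hh hp he').symm)]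

theorem isFramedAt (C : CircleAction D m) {h : ℂ} (hh : h ≠ 0) {p : P2}
    (hp : p.rep 1 = -h * p.rep 2) (hpm : p ∈ complMinus) : D.IsFramedAt p := by
  refine ⟨fun r => ?_, fun e => ⟨C.readE hh hp e, (C.frames_iff hh hp hpm _ _).2 rfl,
    fun r hr => (C.readE_of_frames hh hp hr).symm⟩⟩
  obtain ⟨e, he⟩ := C.exists_frames hh hp r
  exact ⟨e, he, fun e' he' => C.readE_injective hh hp hpm
    ((C.readE_of_frames hh hp he').trans (C.readE_of_frames hh hp he).symm)⟩

/-! ### The chain of sub-bundles and the rational map -/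

/-- The smallest of the `i + 1` largest weights. -/
def topWeight (m : Fin N → ℤ) (i : Fin (N - 1)) : ℤ := m ⟨N - 1 - i.1, by omega⟩

theorem topWeight_le_iff (hm : StrictMono m) (i : Fin (N - 1)) (j : Fin N) :
    topWeight m i ≤ m j ↔ N ≤ j.1 + (i.1 + 1) := by
  rw [topWeight, hm.le_iff_le, Fin.le_def]
  simp only
  omega

theorem card_topWeight_le (hm : StrictMono m) (i : Fin (N - 1)) :
    (Finset.univ.filter fun j => topWeight m i ≤ m j).card = i.1 + 1 := by
  have h : (Finset.univ.filter fun j => topWeight m i ≤ m j) =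
      Finset.Ici (⟨N - 1 - i.1, by omega⟩ : Fin N) := by
    ext j
    simp [topWeight, hm.le_iff_le]
  rw [h, Fin.card_Ici]
  simp only
  omega

theorem topWeight_anti (hm : StrictMono m) {i j : Fin (N - 1)} (h : i ≤ j) :
    topWeight m j ≤ topWeight m i := by
  rw [topWeight, topWeight, hm.le_iff_le, Fin.le_def]
  have : i.1 ≤ j.1 := h
  simp only
  omega

theorem isInvariantChain_filtE (hm : StrictMono m) :
    C.IsInvariantChain fun i q => C.filtE (topWeight m i) q.1 where
  subbundle i := C.isHolomorphicSubbundle_filtE _ (card_topWeight_le hm i)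
  chain _ _ h q := C.filtE_anti (topWeight_anti hm h) q.1
  invariant i t p q h := C.map_act_filtE _ t p q h
  restrict i p hp := by
    simp only [C.filtE_eq_iSup_factor _ hp, topWeight_le_iff hm]

/-- Since the weights are distinct, the last i + 1 factors are exactly those of weight at least
`topWeight m i`, so both the rank and the restriction to y = 0 fit `CircleAction.eq_filtE`. -/
theorem IsInvariantChain.eq_filtE (hm : StrictMono m)
    {L : Fin (N - 1) → ∀ q : complMinus, Submodule ℂ (D.E q)} (hL : C.IsInvariantChain L)
    (i : Fin (N - 1)) (q : complMinus) : L i q = C.filtE (topWeight m i) q.1 := by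
  refine C.eq_filtE ((card_topWeight_le hm i).symm ▸ hL.subbundle i)
    (fun t p q h => (hL.invariant i t p q h).le) (fun p hp => ?_) q
  rw [hL.restrict i p hp, C.filtE_eq_iSup_factor _ hp]
  simp only [topWeight_le_iff hm, le_refl]

/-- The flag in `ℂ^N` at a point of the line `y = -h z`. -/
def flag (hm : StrictMono m) {h : ℂ} (hh : h ≠ 0) (u : P1) : FullFlag N where
  V i := (C.filtE (topWeight m i) (horoPoint h u)).map (C.readE hh (horoPoint_rep h u))
  finrank_eq i := by
    rw [← (Submodule.equivMapOfInjective _ (C.readE_injective hh (horoPoint_rep h u)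
      (horoPoint_mem h u)) _).finrank_eq, C.finrank_filtE _ ⟨_, horoPoint_mem h u⟩,
      card_topWeight_le hm]
  mono _ _ h' := Submodule.map_mono (C.filtE_anti (topWeight_anti hm h') _)

/-- `readK` has constant coefficients along the horosphere line, so applied to a polynomial frame
and restricted to the line it gives vectors with homogeneous coordinates of one common degree. By
`mem_range_A` they stay independent wherever the frame does. -/
theorem isRational_flag (hm : StrictMono m) {h : ℂ} (hh : h ≠ 0) :
    FullFlag.IsRational (C.flag hm hh) := by
  intro i u₀
  obtain ⟨d, e, g, s, hg, hs, hgY, hsk, hind⟩ := C.exists_frame _ (card_topWeight_le hm i)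
    (limVec_horoVec_ne_zero h u₀.rep_nonzero)
  obtain ⟨g', hg', hg'e⟩ := (hg.comp_linear (horoVec h)) LinearMap.id
  choose w hw hwe using fun j k =>
    (((hs j).map (C.readK hh)).comp_linear (horoVec h)) (LinearMap.proj k)
  refine ⟨d, e, g', w, hg', hw, ?_, ?_⟩
  · rw [hg'e]
    exact hgY
  · intro u hu hgu
    rw [hg'e] at hgu
    have hwe' : (fun j k => MvPolynomial.eval u (w j k)) =
        fun j => C.readK hh (s j (horoVec h u)) :=
      funext fun j => funext fun k => hwe j k u
    have hX1 : horoVec h u 1 = -h * horoVec h u 2 := rfl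
    have hli : LinearIndependent ℂ fun j => C.readK hh (s j (horoVec h u)) := by
      rw [Fintype.linearIndependent_iff]
      intro c hc
      have hX := limVec_horoVec_ne_zero h hu
      refine congrFun (hind _ hX hgu c (C.mem_range_A hh hX1 hX ?_ ?_))
      · simp [(hsk _ _).2]
      · simpa using hc
    rw [hwe']
    refine ⟨hli, Submodule.eq_of_le_of_finrank_eq ?_ ?_⟩
    · rw [Submodule.span_le]
      rintro _ ⟨j, rfl⟩
      have hk : s j (horoVec h u) ∈ D.ker (horoPoint h (Projectivization.mk ℂ u hu)) := by
        rw [horoPoint_mk, D.ker_mk]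
        exact (hsk j _).2
      exact ⟨D.cls _ ⟨_, hk⟩, C.mem_filtE.2 ⟨_, (hsk j _).1, hk, rfl⟩, rfl⟩
    · rw [finrank_span_eq_card hli, Fintype.card_fin, FullFlag.finrank_eq]

end CircleAction

end HyperbolicMonopole

end

theorem mainTheorem8 {κ N : ℕ} (D : HyperbolicMonopole.FramedMonad κ N) (m : Fin N → ℤ)
    (hm : StrictMono m) (C : HyperbolicMonopole.CircleAction D m) :
    (∃! L : Fin (N - 1) → ∀ q : HyperbolicMonopole.complMinus, Submodule ℂ (D.E q),
      C.IsInvariantChain L) ∧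
    ∀ L : Fin (N - 1) → ∀ q : HyperbolicMonopole.complMinus, Submodule ℂ (D.E q),
      C.IsInvariantChain L → ∀ h : ℂ, h ≠ 0 →
        (∀ u, D.IsFramedAt (HyperbolicMonopole.horoPoint h u)) ∧
        ∃ f : HyperbolicMonopole.P1 → HyperbolicMonopole.FullFlag N,
          HyperbolicMonopole.FullFlag.IsRational f ∧
          ∀ u i r, r ∈ (f u).V i ↔
            ∃ e ∈ L i ⟨HyperbolicMonopole.horoPoint h u, HyperbolicMonopole.horoPoint_mem h u⟩,
              D.Frames (HyperbolicMonopole.horoPoint h u) r e := by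
  refine ⟨⟨_, C.isInvariantChain_filtE hm, fun L hL => funext fun i => funext fun q =>
    hL.eq_filtE C hm i q⟩, fun L hL h hh => ⟨fun u => C.isFramedAt hh
      (HyperbolicMonopole.horoPoint_rep h u) (HyperbolicMonopole.horoPoint_mem h u),
      C.flag hm hh, C.isRational_flag hm hh, fun u i r => ?_⟩⟩
  rw [hL.eq_filtE C hm]
  refine exists_congr fun e => and_congr_right fun _ => ?_
  exact (C.frames_iff hh (HyperbolicMonopole.horoPoint_rep h u)
    (HyperbolicMonopole.horoPoint_mem h u) r e).symm
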